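/- **Setting.** Let $\mathfrak g$ be a complex Lie algebra and $U\mathfrak g$ its enveloping algebra with the standard cocommutative Hopf structure $\Delta,\varepsilon,S$. Let $\rho=(\rho^i_j)_{i,j\in I}$ be a representation of $U\mathfrak g$ on $\mathbb C^I$, $I$ finite. Let $\mathcal A$ be the unital $\mathbb C$-algebra generated by $a^i,a^+_i$ ($i\in I$) with relations $$a^ia^j=\pm a^ja^i,\qquad a^+_ia^+_j=\pm a^+_ja^+_i,\qquad a^ia^+_j=\delta^i_j\mathbf 1\pm a^+_ja^i,$$ the upper sign giving the Weyl algebra, the lower sign the Clifford algebra (same sign throughout). Let $\sigma:U\mathfrak g\to\mathcal A$ be the (Jordan–Schwinger) algebra homomorphism with $\sigma(X)=\sum_{i,j}\rho(X)^i_j\,a^+_ia^j$ for $X\in\mathfrak g$. All maps are extended coefficientwise to formal power series in $h$. Let $\mathcal F=\mathcal F^{(1)}\otimes\mathcal F^{(2)}\in(U\mathfrak g\otimes U\mathfrak g)[[h]]$ (summation understood) be a twist, i.e. $(\varepsilon\otimes\mathrm{id})\mathcal F=\mathbf 1=(\mathrm{id}\otimes\varepsilon)\mathcal F$ and $\mathcal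 F=\mathbf 1\otimes\mathbf 1+O(h)$; write $\mathcal F^{-1}=\mathcal F^{-1(1)}\otimes\mathcal F^{-1(2)}$. Put $$\gamma=S(\mathcal F^{-1(1)})\,\mathcal F^{-1(2)},\qquad \gamma^{-1}=\mathcal F^{(1)}\,S(\mathcal F^{(2)}),\qquad \gamma'=\mathcal F^{(2)}\,S(\mathcal F^{(1)}).$$ Let $U_h\mathfrak g$ be the algebra $U\mathfrak g[[h]]$ with $\Delta_h(x)=\mathcal F\Delta(x)\mathcal F^{-1}=x_{(\bar1)}\otimes x_{(\bar2)}$, $S_h(x)=\gamma^{-1}S(x)\gamma$, and $\mathcal R=\mathcal F_{21}\mathcal F^{-1}$. Let $R=(\rho\otimes\rho)(\mathcal R)$, i.e. $R^{ij}_{hk}=\rho(\mathcal R^{(1)})^i_h\,\rho(\mathcal R^{(2)})^j_k\in\mathbb C[[h]]$, and let $x\triangleright_h b=\sigma(x_{(\bar1)})\,b\,\sigma(S_hx_{(\bar2)})$ for $x\in U\mathfrak g[[h]]$, $b\in\mathcal A[[h]]$. Define in $\mathcal A[[h]]$ $$A^+_i=\sigma(\mathcal F^{(1)})\,a^+_i\,\sigma(S(\mathcal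 F^{(2)})\gamma),\qquad A^i=\sigma(\gamma' S(\mathcal F^{-1(2)}))\,a^i\,\sigma(\mathcal F^{-1(1)}).$$ **Theorem.** Suppose that $\mathcal F$ satisfies the cocycle condition $(\mathcal F\otimes\mathbf 1)\,(\Delta\otimes\mathrm{id})(\mathcal F)=(\mathbf 1\otimes\mathcal F)\,(\mathrm{id}\otimes\Delta)(\mathcal F)$ (so that $U_h\mathfrak g$ is triangular). Then for all $i,j\in I$, with summation over the repeated indices $u,v\in I$: 1. $A^iA^+_j=\delta^i_j\mathbf 1\pm R^{ui}_{jv}\,A^+_uA^v$, $\quad A^iA^j=\pm R^{ij}_{vu}\,A^uA^v$, $\quad A^+_iA^+_j=\pm R^{vu}_{ij}\,A^+_uA^+_v$. 2. The $A^+_i,A^i$ are $U_h\mathfrak g$-covariant: for all $x\in U\mathfrak g[[h]]$, $x\triangleright_hA^+_i=\sum_l\rho(x)^l_i\,A^+_l$ and $x\triangleright_hA^i=\sum_l\rho(S_hx)^i_l\,A^l$. 3. Let $\mathcal A_h$ be the $\mathbb C[[h]]$-algebra generated by $\tilde A^i,\tilde A^+_i$ ($i\in I$) subject to the three families of relations in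 1 (with $\tilde A$ in place of $A$). The assignment $\tilde A^i\mapsto A^i$, $\tilde A^+_i\mapsto A^+_i$ defines a unique $\mathbb C[[h]]$-algebra homomorphism $f:\mathcal A_h\to\mathcal A[[h]]$, and $f$ is a deforming map, i.e. a formal change of generators: $A^i=a^i+O(h)$, $A^+_i=a^+_i+O(h)$, and for every $n\ge 0$, $f$ induces a bijection $\mathcal A_h/h^n\mathcal A_h\to\mathcal A[[h]]/h^n\mathcal A[[h]]$. -/

import Mathlib

open scoped TensorProduct PowerSeries

noncomputable section

attribute [local instance] LieRing.ofAssociativeRing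

/-! ## The cocommutative Hopf algebra `U𝔤` -/

namespace UniversalEnvelopingAlgebra

variable {𝔤 : Type*} [LieRing 𝔤] [LieAlgebra ℂ 𝔤]

/-- Primitive comultiplication `Δ(x) = x ⊗ 1 + 1 ⊗ x` for `x ∈ 𝔤`. -/
def comulHom : UniversalEnvelopingAlgebra ℂ 𝔤 →ₐ[ℂ]
    UniversalEnvelopingAlgebra ℂ 𝔤 ⊗[ℂ] UniversalEnvelopingAlgebra ℂ 𝔤 :=
  lift ℂ
    { toFun := fun x => ι ℂ x ⊗ₜ 1 + 1 ⊗ₜ ι ℂ x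
      map_add' := fun x y => by
        simp only [map_add, TensorProduct.add_tmul, TensorProduct.tmul_add]; abel
      map_smul' := fun c x => by
        simp only [map_smul, TensorProduct.smul_tmul', TensorProduct.tmul_smul, smul_add,
          RingHom.id_apply]
      map_lie' := fun {x y} => by
        simp only [LieHom.map_lie, LieRing.of_associative_ring_bracket, mul_add, add_mul,
          Algebra.TensorProduct.tmul_mul_tmul, one_mul, mul_one, TensorProduct.sub_tmul,
          TensorProduct.tmul_sub]
        abel }

/-- The counit, `ε(x) = 0` for `x ∈ 𝔤`. -/
def counitHom : UniversalEnvelopingAlgebra ℂ 𝔤 →ₐ[ℂ] ℂ := lift ℂ 0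

/-- The antipode as an algebra homomorphism to the opposite algebra, `S(x) = -x` for `x ∈ 𝔤`. -/
def antipodeHom : UniversalEnvelopingAlgebra ℂ 𝔤 →ₐ[ℂ] (UniversalEnvelopingAlgebra ℂ 𝔤)ᵐᵒᵖ :=
  lift ℂ
    { toFun := fun x => MulOpposite.op (-ι ℂ x)
      map_add' := fun x y => by simp [add_comm]
      map_smul' := fun c x => by simp
      map_lie' := fun {x y} => by
        simp only [LieHom.map_lie, LieRing.of_associative_ring_bracket, ← MulOpposite.op_mul,
          ← MulOpposite.op_sub]
        congr 1
        noncomm_ring }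

/-- The antipode of `U𝔤` as a linear map. -/
def antipodeLin : UniversalEnvelopingAlgebra ℂ 𝔤 →ₗ[ℂ] UniversalEnvelopingAlgebra ℂ 𝔤 :=
  (MulOpposite.opLinearEquiv ℂ).symm.toLinearMap ∘ₗ antipodeHom.toLinearMap

theorem comulHom_ι (x : 𝔤) : comulHom (ι ℂ x) = ι ℂ x ⊗ₜ[ℂ] 1 + 1 ⊗ₜ[ℂ] ι ℂ x :=
  lift_ι_apply ℂ _ x

theorem counitHom_ι (x : 𝔤) : counitHom (ι ℂ x) = 0 := lift_ι_apply ℂ _ x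

theorem antipodeLin_ι (x : 𝔤) : antipodeLin (ι ℂ x) = -ι ℂ x := by
  have h : antipodeHom (ι ℂ x) = MulOpposite.op (-ι ℂ x) := lift_ι_apply ℂ _ x
  change MulOpposite.unop (antipodeHom (ι ℂ x)) = _
  rw [h, MulOpposite.unop_op]

theorem antipodeLin_one : antipodeLin (1 : UniversalEnvelopingAlgebra ℂ 𝔤) = 1 := by
  simp [antipodeLin]

theorem antipodeLin_mul (u v : UniversalEnvelopingAlgebra ℂ 𝔤) :
    antipodeLin (u * v) = antipodeLin v * antipodeLin u := by
  simp [antipodeLin]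

/-- `U𝔤` is generated by `𝔤`. -/
theorem mem_of_ι_mem (P : Subalgebra ℂ (UniversalEnvelopingAlgebra ℂ 𝔤))
    (hP : ∀ x : 𝔤, ι ℂ x ∈ P) (u : UniversalEnvelopingAlgebra ℂ 𝔤) : u ∈ P := by
  let f : UniversalEnvelopingAlgebra ℂ 𝔤 →ₐ[ℂ] P := lift ℂ
    { toFun := fun x => ⟨ι ℂ x, hP x⟩
      map_add' := fun x y => by ext; simp only [map_add]; rfl
      map_smul' := fun c x => by ext; simp only [map_smul]; rfl
      map_lie' := fun {x y} => by ext; simp only [LieHom.map_lie]; rfl }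
  have hf : P.val.comp f = AlgHom.id ℂ _ := by
    apply hom_ext
    apply LieHom.ext
    intro x
    change P.val (f (ι ℂ x)) = ι ℂ x
    have h : f (ι ℂ x) = ⟨ι ℂ x, hP x⟩ := lift_ι_apply ℂ _ x
    rw [h]; rfl
  have := congrArg (fun g => g u) hf
  simp only [AlgHom.comp_apply, AlgHom.id_apply] at this
  rw [← this]
  exact (f u).2

theorem algHom_ext_ι {A : Type*} [Semiring A] [Algebra ℂ A]
    {f g : UniversalEnvelopingAlgebra ℂ 𝔤 →ₐ[ℂ] A} (h : ∀ x : 𝔤, f (ι ℂ x) = g (ι ℂ x)) :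
    f = g :=
  AlgHom.ext (mem_of_ι_mem (AlgHom.equalizer f g) h)

instance instBialgebra : Bialgebra ℂ (UniversalEnvelopingAlgebra ℂ 𝔤) :=
  Bialgebra.ofAlgHom comulHom counitHom
    (algHom_ext_ι fun x => by
      change Algebra.TensorProduct.assoc ℂ ℂ ℂ _ _ _ (Algebra.TensorProduct.map _ _
        (comulHom (ι ℂ x))) = Algebra.TensorProduct.map _ _ (comulHom (ι ℂ x))
      rw [comulHom_ι, map_add, map_add, map_add]
      simp only [Algebra.TensorProduct.map_tmul, comulHom_ι, map_one, AlgHom.id_apply,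
        TensorProduct.add_tmul, TensorProduct.tmul_add, Algebra.TensorProduct.one_def, map_add,
        Algebra.TensorProduct.assoc_tmul, add_assoc])
    (algHom_ext_ι fun x => by
      change Algebra.TensorProduct.map _ _ (comulHom (ι ℂ x)) =
        (Algebra.TensorProduct.lid ℂ _).symm (ι ℂ x)
      rw [comulHom_ι, map_add, Algebra.TensorProduct.map_tmul, Algebra.TensorProduct.map_tmul,
        counitHom_ι, map_one counitHom, TensorProduct.zero_tmul, zero_add]
      rfl)
    (algHom_ext_ι fun x => by
      change Algebra.TensorProduct.map _ _ (comulHom (ι ℂ x)) =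
        (Algebra.TensorProduct.rid ℂ ℂ _).symm (ι ℂ x)
      rw [comulHom_ι, map_add, Algebra.TensorProduct.map_tmul, Algebra.TensorProduct.map_tmul,
        counitHom_ι, map_one counitHom, TensorProduct.tmul_zero, add_zero]
      rfl)

theorem antipode_left (u : UniversalEnvelopingAlgebra ℂ 𝔤) :
    LinearMap.mul' ℂ _ (antipodeLin.rTensor _ (comulHom u)) =
      algebraMap ℂ (UniversalEnvelopingAlgebra ℂ 𝔤) (counitHom u) := by
  have key : ∀ t p q, LinearMap.mul' ℂ (UniversalEnvelopingAlgebra ℂ 𝔤)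
      (antipodeLin.rTensor _ (t * p ⊗ₜ q)) =
      antipodeLin p * LinearMap.mul' ℂ _ (antipodeLin.rTensor _ t) * q := by
    intro t p q
    induction t with
    | zero => simp
    | tmul x y => simp [antipodeLin_mul, mul_assoc]
    | add s t hs ht => simp only [add_mul, map_add, hs, ht, mul_add]
  refine mem_of_ι_mem
    { carrier := {u | LinearMap.mul' ℂ _ (antipodeLin.rTensor _ (comulHom u)) =
        algebraMap ℂ (UniversalEnvelopingAlgebra ℂ 𝔤) (counitHom u)}
      mul_mem' := ?_, add_mem' := ?_, algebraMap_mem' := ?_ } ?_ u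
  · intro a b ha hb
    simp only [Set.mem_ofPred_eq] at ha hb ⊢
    have : ∀ w, LinearMap.mul' ℂ (UniversalEnvelopingAlgebra ℂ 𝔤)
        (antipodeLin.rTensor _ (comulHom a * w)) =
        algebraMap ℂ _ (counitHom a) * LinearMap.mul' ℂ _ (antipodeLin.rTensor _ w) := by
      intro w
      induction w with
      | zero => simp
      | tmul p q =>
        rw [key, ha]
        simp only [LinearMap.rTensor_tmul, LinearMap.mul'_apply, ← Algebra.commutes, mul_assoc]
      | add s t hs ht => simp only [mul_add, map_add, hs, ht]
    rw [map_mul, this, hb, map_mul, map_mul]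
  · intro a b ha hb
    simp only [Set.mem_ofPred_eq] at ha hb ⊢
    simp only [map_add, ha, hb]
  · intro r
    simp [Algebra.algebraMap_eq_smul_one, Algebra.TensorProduct.one_def, antipodeLin_one]
  · intro x
    change LinearMap.mul' ℂ _ (antipodeLin.rTensor _ (comulHom (ι ℂ x))) =
        algebraMap ℂ (UniversalEnvelopingAlgebra ℂ 𝔤) (counitHom (ι ℂ x))
    rw [comulHom_ι, counitHom_ι, map_add, map_add, LinearMap.rTensor_tmul, LinearMap.rTensor_tmul,
      LinearMap.mul'_apply, LinearMap.mul'_apply, antipodeLin_ι, antipodeLin_one]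
    simp

theorem antipode_right (u : UniversalEnvelopingAlgebra ℂ 𝔤) :
    LinearMap.mul' ℂ _ (antipodeLin.lTensor _ (comulHom u)) =
      algebraMap ℂ (UniversalEnvelopingAlgebra ℂ 𝔤) (counitHom u) := by
  have key : ∀ t p q, LinearMap.mul' ℂ (UniversalEnvelopingAlgebra ℂ 𝔤)
      (antipodeLin.lTensor _ (p ⊗ₜ q * t)) =
      p * LinearMap.mul' ℂ _ (antipodeLin.lTensor _ t) * antipodeLin q := by
    intro t p q
    induction t with
    | zero => simp
    | tmul x y => simp [antipodeLin_mul, mul_assoc]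
    | add s t hs ht => simp only [add_mul, map_add, hs, ht, mul_add]
  refine mem_of_ι_mem
    { carrier := {u | LinearMap.mul' ℂ _ (antipodeLin.lTensor _ (comulHom u)) =
        algebraMap ℂ (UniversalEnvelopingAlgebra ℂ 𝔤) (counitHom u)}
      mul_mem' := ?_, add_mem' := ?_, algebraMap_mem' := ?_ } ?_ u
  · intro a b ha hb
    simp only [Set.mem_ofPred_eq] at ha hb ⊢
    have : ∀ w, LinearMap.mul' ℂ (UniversalEnvelopingAlgebra ℂ 𝔤)
        (antipodeLin.lTensor _ (w * comulHom b)) =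
        LinearMap.mul' ℂ _ (antipodeLin.lTensor _ w) * algebraMap ℂ _ (counitHom b) := by
      intro w
      induction w with
      | zero => simp
      | tmul p q =>
        rw [key, hb]
        simp only [LinearMap.lTensor_tmul, LinearMap.mul'_apply, Algebra.commutes, mul_assoc]
      | add s t hs ht => simp only [add_mul, map_add, hs, ht]
    rw [map_mul, this, ha, map_mul, map_mul]
  · intro a b ha hb
    simp only [Set.mem_ofPred_eq] at ha hb ⊢
    simp only [map_add, ha, hb]
  · intro r
    simp [Algebra.algebraMap_eq_smul_one, Algebra.TensorProduct.one_def, antipodeLin_one]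
  · intro x
    change LinearMap.mul' ℂ _ (antipodeLin.lTensor _ (comulHom (ι ℂ x))) =
        algebraMap ℂ (UniversalEnvelopingAlgebra ℂ 𝔤) (counitHom (ι ℂ x))
    rw [comulHom_ι, counitHom_ι, map_add, map_add, LinearMap.lTensor_tmul, LinearMap.lTensor_tmul,
      LinearMap.mul'_apply, LinearMap.mul'_apply, antipodeLin_ι, antipodeLin_one]
    simp

instance instHopfAlgebra : HopfAlgebra ℂ (UniversalEnvelopingAlgebra ℂ 𝔤) where
  antipode := antipodeLin
  mul_antipode_rTensor_comul := LinearMap.ext antipode_left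
  mul_antipode_lTensor_comul := LinearMap.ext antipode_right

end UniversalEnvelopingAlgebra

namespace DeformedCCR

open PowerSeries

/-- The enveloping algebra `U𝔤` over `ℂ`. -/
abbrev Ug (𝔤 : Type*) [LieRing 𝔤] [LieAlgebra ℂ 𝔤] : Type _ := UniversalEnvelopingAlgebra ℂ 𝔤

/-- Coefficientwise extension of a linear map to formal power series in `h`. -/
def mapCoeff {M N : Type*} [Semiring M] [Algebra ℂ M] [Semiring N] [Algebra ℂ N]
    (f : M →ₗ[ℂ] N) (x : M⟦X⟧) : N⟦X⟧ :=
  PowerSeries.mk fun n => f (coeff n x)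

/-! ## Twists and the twisted Hopf algebra `H_h` -/

section Twist

variable (𝔤 : Type*) [LieRing 𝔤] [LieAlgebra ℂ 𝔤]

/-- `ε ⊗ id : U𝔤 ⊗ U𝔤 → U𝔤`. -/
def counitLeft : Ug 𝔤 ⊗[ℂ] Ug 𝔤 →ₐ[ℂ] Ug 𝔤 :=
  (Algebra.TensorProduct.lid ℂ (Ug 𝔤)).toAlgHom.comp
    (Algebra.TensorProduct.map (Bialgebra.counitAlgHom ℂ (Ug 𝔤)) (AlgHom.id ℂ (Ug 𝔤)))

/-- `id ⊗ ε : U𝔤 ⊗ U𝔤 → U𝔤`. -/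
def counitRight : Ug 𝔤 ⊗[ℂ] Ug 𝔤 →ₐ[ℂ] Ug 𝔤 :=
  (Algebra.TensorProduct.rid ℂ ℂ (Ug 𝔤)).toAlgHom.comp
    (Algebra.TensorProduct.map (AlgHom.id ℂ (Ug 𝔤)) (Bialgebra.counitAlgHom ℂ (Ug 𝔤)))

/-- `Δ ⊗ id : U𝔤 ⊗ U𝔤 → U𝔤 ⊗ (U𝔤 ⊗ U𝔤)`. -/
def comulLeft : Ug 𝔤 ⊗[ℂ] Ug 𝔤 →ₐ[ℂ] Ug 𝔤 ⊗[ℂ] (Ug 𝔤 ⊗[ℂ] Ug 𝔤) :=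
  (Algebra.TensorProduct.assoc ℂ ℂ ℂ (Ug 𝔤) (Ug 𝔤) (Ug 𝔤)).toAlgHom.comp
    (Algebra.TensorProduct.map (Bialgebra.comulAlgHom ℂ (Ug 𝔤)) (AlgHom.id ℂ (Ug 𝔤)))

/-- `id ⊗ Δ : U𝔤 ⊗ U𝔤 → U𝔤 ⊗ (U𝔤 ⊗ U𝔤)`. -/
def comulRight : Ug 𝔤 ⊗[ℂ] Ug 𝔤 →ₐ[ℂ] Ug 𝔤 ⊗[ℂ] (Ug 𝔤 ⊗[ℂ] Ug 𝔤) :=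
  Algebra.TensorProduct.map (AlgHom.id ℂ (Ug 𝔤)) (Bialgebra.comulAlgHom ℂ (Ug 𝔤))

/-- `t ↦ t ⊗ 1`. -/
def leg12 : Ug 𝔤 ⊗[ℂ] Ug 𝔤 →ₐ[ℂ] Ug 𝔤 ⊗[ℂ] (Ug 𝔤 ⊗[ℂ] Ug 𝔤) :=
  (Algebra.TensorProduct.assoc ℂ ℂ ℂ (Ug 𝔤) (Ug 𝔤) (Ug 𝔤)).toAlgHom.comp
    Algebra.TensorProduct.includeLeft

/-- `t ↦ 1 ⊗ t`. -/
def leg23 : Ug 𝔤 ⊗[ℂ] Ug 𝔤 →ₐ[ℂ] Ug 𝔤 ⊗[ℂ] (Ug 𝔤 ⊗[ℂ] Ug 𝔤) :=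
  Algebra.TensorProduct.includeRight

/-- The flip `x ⊗ y ↦ y ⊗ x`. -/
def flip : Ug 𝔤 ⊗[ℂ] Ug 𝔤 →ₐ[ℂ] Ug 𝔤 ⊗[ℂ] Ug 𝔤 :=
  (Algebra.TensorProduct.comm ℂ (Ug 𝔤) (Ug 𝔤)).toAlgHom

/-- `S ⊗ id`. -/
def antipodeLeft : Ug 𝔤 ⊗[ℂ] Ug 𝔤 →ₗ[ℂ] Ug 𝔤 ⊗[ℂ] Ug 𝔤 :=
  (HopfAlgebra.antipode ℂ (A := Ug 𝔤)).rTensor (Ug 𝔤)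

/-- `id ⊗ S`. -/
def antipodeRight : Ug 𝔤 ⊗[ℂ] Ug 𝔤 →ₗ[ℂ] Ug 𝔤 ⊗[ℂ] Ug 𝔤 :=
  (HopfAlgebra.antipode ℂ (A := Ug 𝔤)).lTensor (Ug 𝔤)

/-- A twist: `ℱ ∈ (U𝔤 ⊗ U𝔤)[[h]]` with `(ε ⊗ id)ℱ = 1 = (id ⊗ ε)ℱ` and `ℱ = 1 ⊗ 1 + O(h)`. -/
structure Twist where
  /-- The underlying power series `ℱ`. -/
  series : (Ug 𝔤 ⊗[ℂ] Ug 𝔤)⟦X⟧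
  counit_left : PowerSeries.map (counitLeft 𝔤 : _ →+* Ug 𝔤) series = 1
  counit_right : PowerSeries.map (counitRight 𝔤 : _ →+* Ug 𝔤) series = 1
  constantCoeff_eq : constantCoeff series = 1

namespace Twist

variable {𝔤} (F : Twist 𝔤)

/-- The inverse power series `ℱ⁻¹`. -/
def inv : (Ug 𝔤 ⊗[ℂ] Ug 𝔤)⟦X⟧ := PowerSeries.invOfUnit F.series 1

theorem mul_inv : F.series * F.inv = 1 :=
  PowerSeries.mul_invOfUnit _ _ (by simpa using F.constantCoeff_eq)

theorem inv_mul : F.inv * F.series = 1 :=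
  PowerSeries.invOfUnit_mul _ _ (by simpa using F.constantCoeff_eq)

/-- The cocycle condition `(ℱ ⊗ 1)(Δ ⊗ id)(ℱ) = (1 ⊗ ℱ)(id ⊗ Δ)(ℱ)`. -/
def IsCocycle : Prop :=
  PowerSeries.map (leg12 𝔤 : _ →+* Ug 𝔤 ⊗[ℂ] (Ug 𝔤 ⊗[ℂ] Ug 𝔤)) F.series *
      PowerSeries.map (comulLeft 𝔤 : _ →+* Ug 𝔤 ⊗[ℂ] (Ug 𝔤 ⊗[ℂ] Ug 𝔤)) F.series =
    PowerSeries.map (leg23 𝔤 : _ →+* Ug 𝔤 ⊗[ℂ] (Ug 𝔤 ⊗[ℂ] Ug 𝔤)) F.series *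
      PowerSeries.map (comulRight 𝔤 : _ →+* Ug 𝔤 ⊗[ℂ] (Ug 𝔤 ⊗[ℂ] Ug 𝔤)) F.series

/-- `γ = S(ℱ⁻¹⁽¹⁾) ℱ⁻¹⁽²⁾`. -/
def gamma : (Ug 𝔤)⟦X⟧ := mapCoeff (LinearMap.mul' ℂ (Ug 𝔤) ∘ₗ antipodeLeft 𝔤) F.inv

/-- `γ⁻¹ = ℱ⁽¹⁾ S(ℱ⁽²⁾)`. -/
def gammaInv : (Ug 𝔤)⟦X⟧ := mapCoeff (LinearMap.mul' ℂ (Ug 𝔤) ∘ₗ antipodeRight 𝔤) F.series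

/-- `γ' = ℱ⁽²⁾ S(ℱ⁽¹⁾)`. -/
def gamma' : (Ug 𝔤)⟦X⟧ :=
  mapCoeff (LinearMap.mul' ℂ (Ug 𝔤) ∘ₗ antipodeRight 𝔤 ∘ₗ (flip 𝔤).toLinearMap) F.series

/-- The twisted coproduct `Δ_h(x) = ℱ Δ(x) ℱ⁻¹`. -/
def comul (x : (Ug 𝔤)⟦X⟧) : (Ug 𝔤 ⊗[ℂ] Ug 𝔤)⟦X⟧ :=
  F.series *
    PowerSeries.map (Bialgebra.comulAlgHom ℂ (Ug 𝔤) : _ →+* Ug 𝔤 ⊗[ℂ] Ug 𝔤) x * F.inv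

/-- The twisted antipode `S_h(x) = γ⁻¹ S(x) γ`. -/
def antipode (x : (Ug 𝔤)⟦X⟧) : (Ug 𝔤)⟦X⟧ :=
  F.gammaInv * mapCoeff (HopfAlgebra.antipode ℂ) x * F.gamma

/-- `id ⊗ S_h` on `(U𝔤 ⊗ U𝔤)[[h]]`: `x ⊗ y ↦ x ⊗ γ⁻¹ S(y) γ`. -/
def idTensorAntipode (t : (Ug 𝔤 ⊗[ℂ] Ug 𝔤)⟦X⟧) : (Ug 𝔤 ⊗[ℂ] Ug 𝔤)⟦X⟧ :=
  PowerSeries.map (Algebra.TensorProduct.includeRight : Ug 𝔤 →ₐ[ℂ] Ug 𝔤 ⊗[ℂ] Ug 𝔤).toRingHom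
      F.gammaInv * mapCoeff (antipodeRight 𝔤) t *
    PowerSeries.map (Algebra.TensorProduct.includeRight : Ug 𝔤 →ₐ[ℂ] Ug 𝔤 ⊗[ℂ] Ug 𝔤).toRingHom
      F.gamma

/-- The universal R-matrix `ℛ = ℱ₂₁ ℱ⁻¹`. -/
def universalR : (Ug 𝔤 ⊗[ℂ] Ug 𝔤)⟦X⟧ :=
  PowerSeries.map (flip 𝔤 : _ →+* Ug 𝔤 ⊗[ℂ] Ug 𝔤) F.series * F.inv

end Twist

end Twist

/-! ## The classical Weyl and Clifford algebras -/

/-- Weyl (upper sign) or Clifford (lower sign) case. -/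
inductive Kind
  | weyl
  | clifford

/-- The sign `±`. -/
def Kind.sign : Kind → ℤ
  | .weyl => 1
  | .clifford => -1

/-- Labels of the generators: annihilators (upper index) and creators (lower index). -/
inductive Gen (I : Type*)
  | ann (i : I)
  | cre (i : I)

section Classical

variable (κ : Kind) (I : Type*) [DecidableEq I]

/-- The canonical (anti)commutation relations, where `[a, b]_± = ab ∓ ba`. -/
inductive ClassicalRel : FreeAlgebra ℂ (Gen I) → FreeAlgebra ℂ (Gen I) → Prop
  | ann_ann (i j : I) : ClassicalRel
      (FreeAlgebra.ι ℂ (.ann i) * FreeAlgebra.ι ℂ (.ann j) -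
        κ.sign • (FreeAlgebra.ι ℂ (.ann j) * FreeAlgebra.ι ℂ (.ann i))) 0
  | cre_cre (i j : I) : ClassicalRel
      (FreeAlgebra.ι ℂ (.cre i) * FreeAlgebra.ι ℂ (.cre j) -
        κ.sign • (FreeAlgebra.ι ℂ (.cre j) * FreeAlgebra.ι ℂ (.cre i))) 0
  | ann_cre (i j : I) : ClassicalRel
      (FreeAlgebra.ι ℂ (.ann i) * FreeAlgebra.ι ℂ (.cre j) -
        κ.sign • (FreeAlgebra.ι ℂ (.cre j) * FreeAlgebra.ι ℂ (.ann i))) (if i = j then 1 else 0)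

/-- The Weyl or Clifford algebra `𝒜`. -/
def OscAlg : Type _ := RingQuot (ClassicalRel κ I)

instance : Ring (OscAlg κ I) := inferInstanceAs (Ring (RingQuot (ClassicalRel κ I)))

instance : Algebra ℂ (OscAlg κ I) := inferInstanceAs (Algebra ℂ (RingQuot (ClassicalRel κ I)))

variable {I}

/-- The generators `a^i` and `a^+_i` of `𝒜`. -/
def OscAlg.gen (g : Gen I) : OscAlg κ I :=
  RingQuot.mkAlgHom ℂ (ClassicalRel κ I) (FreeAlgebra.ι ℂ g)

/-- `a^i`. -/
abbrev a (i : I) : OscAlg κ I := OscAlg.gen κ (.ann i)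

/-- `a^+_i`. -/
abbrev aPlus (i : I) : OscAlg κ I := OscAlg.gen κ (.cre i)

variable (I) in
/-- `𝒜[[h]]` is an algebra over `ℂ[[h]]`. -/
instance : Algebra ℂ⟦X⟧ (OscAlg κ I)⟦X⟧ :=
  RingHom.toAlgebra' (PowerSeries.map (algebraMap ℂ (OscAlg κ I))) fun c x => by
    ext n
    simp only [PowerSeries.coeff_mul, PowerSeries.coeff_map]
    rw [← Finset.Nat.sum_antidiagonal_swap]
    exact Finset.sum_congr rfl fun p _ => Algebra.commutes _ _

variable {κ}

theorem OscAlg.ann_mul_ann (i j : I) : a κ i * a κ j = κ.sign • (a κ j * a κ i) := by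
  have h := RingQuot.mkAlgHom_rel ℂ (ClassicalRel.ann_ann (κ := κ) i j)
  rw [map_sub, map_zsmul, map_mul, map_mul, map_zero] at h
  exact sub_eq_zero.1 h

theorem OscAlg.cre_mul_cre (i j : I) :
    aPlus κ i * aPlus κ j = κ.sign • (aPlus κ j * aPlus κ i) := by
  have h := RingQuot.mkAlgHom_rel ℂ (ClassicalRel.cre_cre (κ := κ) i j)
  rw [map_sub, map_zsmul, map_mul, map_mul, map_zero] at h
  exact sub_eq_zero.1 h

theorem OscAlg.ann_mul_cre (i j : I) :
    a κ i * aPlus κ j = (if i = j then 1 else 0) + κ.sign • (aPlus κ j * a κ i) := by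
  have h := RingQuot.mkAlgHom_rel ℂ (ClassicalRel.ann_cre (κ := κ) i j)
  rw [map_sub, map_zsmul, map_mul, map_mul, apply_ite (RingQuot.mkAlgHom ℂ _), map_one,
    map_zero] at h
  exact sub_eq_iff_eq_add.1 h

/-- `[a^+_i a^j, a^+_k a^l] = δ^j_k a^+_i a^l - δ^l_i a^+_k a^j`. -/
theorem OscAlg.quadratic_commutator (i j k l : I) :
    (aPlus κ i * a κ j) * (aPlus κ k * a κ l) - (aPlus κ k * a κ l) * (aPlus κ i * a κ j) =
      (if j = k then aPlus κ i * a κ l else 0) - (if l = i then aPlus κ k * a κ j else 0) := by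
  have h1 : (aPlus κ i * a κ j) * (aPlus κ k * a κ l) =
      (if j = k then aPlus κ i * a κ l else 0) +
        κ.sign • (aPlus κ i * aPlus κ k * (a κ j * a κ l)) := by
    rw [mul_assoc, ← mul_assoc (a κ j), ann_mul_cre]
    simp only [add_mul, mul_add, ite_mul, one_mul, zero_mul, mul_ite, mul_zero, smul_mul_assoc,
      mul_smul_comm, mul_assoc]
  have h2 : (aPlus κ k * a κ l) * (aPlus κ i * a κ j) =
      (if l = i then aPlus κ k * a κ j else 0) +
        κ.sign • (aPlus κ k * aPlus κ i * (a κ l * a κ j)) := by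
    rw [mul_assoc, ← mul_assoc (a κ l), ann_mul_cre]
    simp only [add_mul, mul_add, ite_mul, one_mul, zero_mul, mul_ite, mul_zero, smul_mul_assoc,
      mul_smul_comm, mul_assoc]
  have h3 : aPlus κ k * aPlus κ i * (a κ l * a κ j) =
      aPlus κ i * aPlus κ k * (a κ j * a κ l) := by
    rw [cre_mul_cre k i, ann_mul_ann l j]
    cases κ <;> simp [Kind.sign]
  rw [h1, h2, h3]
  abel

variable (κ) in
/-- `M ↦ M^i_j a^+_i a^j`. -/
def quadratic [Fintype I] : Matrix I I ℂ →ₗ[ℂ] OscAlg κ I where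
  toFun M := ∑ i, ∑ j, M i j • (aPlus κ i * a κ j)
  map_add' M N := by simp only [Matrix.add_apply, add_smul, Finset.sum_add_distrib]
  map_smul' c M := by
    simp only [Matrix.smul_apply, smul_eq_mul, mul_smul, Finset.smul_sum, RingHom.id_apply]

theorem quadratic_lie [Fintype I] (M N : Matrix I I ℂ) :
    quadratic κ (M * N - N * M) =
      quadratic κ M * quadratic κ N - quadratic κ N * quadratic κ M := by
  have e1 : quadratic κ M * quadratic κ N =
      ∑ i, ∑ j, ∑ k, ∑ l, (M i j * N k l) • ((aPlus κ i * a κ j) * (aPlus κ k * a κ l)) := by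
    simp only [quadratic, LinearMap.coe_mk, AddHom.coe_mk]
    rw [Finset.sum_mul]
    refine Finset.sum_congr rfl fun i _ => ?_
    rw [Finset.sum_mul]
    refine Finset.sum_congr rfl fun j _ => ?_
    simp only [Finset.mul_sum, smul_mul_smul_comm]
  have e2 : quadratic κ N * quadratic κ M =
      ∑ i, ∑ j, ∑ k, ∑ l, (M i j * N k l) • ((aPlus κ k * a κ l) * (aPlus κ i * a κ j)) := by
    simp only [quadratic, LinearMap.coe_mk, AddHom.coe_mk]
    rw [Finset.mul_sum]
    refine Finset.sum_congr rfl fun i _ => ?_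
    rw [Finset.mul_sum]
    refine Finset.sum_congr rfl fun j _ => ?_
    simp only [Finset.sum_mul, smul_mul_smul_comm, mul_comm (M i j)]
  have e3 : quadratic κ (M * N) =
      ∑ i, ∑ j, ∑ k, ∑ l, (M i j * N k l) • (if j = k then aPlus κ i * a κ l else 0) := by
    simp only [quadratic, LinearMap.coe_mk, AddHom.coe_mk, Matrix.mul_apply, Finset.sum_smul]
    refine Finset.sum_congr rfl fun i _ => ?_
    rw [Finset.sum_comm]
    refine Finset.sum_congr rfl fun j _ => ?_
    rw [Finset.sum_comm]
    refine Finset.sum_congr rfl fun l _ => ?_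
    simp
  have e4 : quadratic κ (N * M) =
      ∑ i, ∑ j, ∑ k, ∑ l, (M i j * N k l) • (if l = i then aPlus κ k * a κ j else 0) := by
    simp only [quadratic, LinearMap.coe_mk, AddHom.coe_mk, Matrix.mul_apply, Finset.sum_smul,
      smul_ite, smul_zero, Finset.sum_ite_eq', Finset.mem_univ, if_true]
    rw [Finset.sum_comm, Finset.sum_comm]
    calc _ = ∑ k, ∑ i, ∑ j, (N k i * M i j) • (aPlus κ k * a κ j) :=
          Finset.sum_congr rfl fun k _ => Finset.sum_comm
      _ = ∑ i, ∑ k, ∑ j, (N k i * M i j) • (aPlus κ k * a κ j) := Finset.sum_comm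
      _ = _ := Finset.sum_congr rfl fun i _ => by
          rw [Finset.sum_comm]
          simp only [mul_comm (M i _)]
  rw [map_sub, e1, e2, e3, e4]
  simp only [← Finset.sum_sub_distrib, ← smul_sub, OscAlg.quadratic_commutator]

end Classical
/-! ## Jordan–Schwinger map, twisted generators, deformed relations -/

section Twisted

variable {𝔤 : Type*} [LieRing 𝔤] [LieAlgebra ℂ 𝔤] {I : Type*} [Fintype I] [DecidableEq I]

/-- The Jordan–Schwinger homomorphism `σ : U𝔤 → 𝒜`, determined by
`σ(X) = ρ(X)^i_j a^+_i a^j` for `X ∈ 𝔤`. -/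
def sigma (κ : Kind) (ρ : Ug 𝔤 →ₐ[ℂ] Matrix I I ℂ) : Ug 𝔤 →ₐ[ℂ] OscAlg κ I :=
  UniversalEnvelopingAlgebra.lift ℂ
    { toFun := fun x => quadratic κ (ρ (UniversalEnvelopingAlgebra.ι ℂ x))
      map_add' := fun x y => by simp only [map_add]
      map_smul' := fun c x => by simp only [map_smul, RingHom.id_apply]
      map_lie' := fun {x y} => by
        simp only [LieHom.map_lie, LieRing.of_associative_ring_bracket, map_sub, map_mul,
          ← quadratic_lie] }

theorem sigma_ι (κ : Kind) (ρ : Ug 𝔤 →ₐ[ℂ] Matrix I I ℂ) (x : 𝔤) :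
    sigma κ ρ (UniversalEnvelopingAlgebra.ι ℂ x) =
      ∑ i, ∑ j, ρ (UniversalEnvelopingAlgebra.ι ℂ x) i j • (aPlus κ i * a κ j) :=
  UniversalEnvelopingAlgebra.lift_ι_apply ℂ _ x

/-- `σ ⊗ σ` applied coefficientwise. -/
def sigma₂ (κ : Kind) (ρ : Ug 𝔤 →ₐ[ℂ] Matrix I I ℂ) (t : (Ug 𝔤 ⊗[ℂ] Ug 𝔤)⟦X⟧) :
    (OscAlg κ I ⊗[ℂ] OscAlg κ I)⟦X⟧ :=
  PowerSeries.map (Algebra.TensorProduct.map (sigma κ ρ) (sigma κ ρ) :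
    _ →+* OscAlg κ I ⊗[ℂ] OscAlg κ I) t

/-- The linear map sending `x ⊗ y` to `b ↦ x b y`. -/
def sandwichLin (A : Type*) [Ring A] [Algebra ℂ A] : A ⊗[ℂ] A →ₗ[ℂ] A →ₗ[ℂ] A :=
  TensorProduct.lift ((LinearMap.mul ℂ (A →ₗ[ℂ] A)).compl₁₂ (LinearMap.mul ℂ A)
    (LinearMap.mul ℂ A).flip)

theorem sandwichLin_tmul {A : Type*} [Ring A] [Algebra ℂ A] (x y b : A) :
    sandwichLin A (x ⊗ₜ y) b = x * b * y := by
  simp [sandwichLin, mul_assoc]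

/-- `t⁽¹⁾ b t⁽²⁾` for `t ∈ (A ⊗ A)[[h]]` and `b ∈ A[[h]]`. -/
def sandwich {A : Type*} [Ring A] [Algebra ℂ A] (t : (A ⊗[ℂ] A)⟦X⟧) (b : A⟦X⟧) : A⟦X⟧ :=
  PowerSeries.mk fun n =>
    ∑ p ∈ Finset.HasAntidiagonal.antidiagonal n, sandwichLin A (coeff p.1 t) (coeff p.2 b)

/-- The matrix element `ρ(x)^i_j ∈ ℂ[[h]]` of `x ∈ U𝔤[[h]]`. -/
def repCoeff (ρ : Ug 𝔤 →ₐ[ℂ] Matrix I I ℂ) (x : (Ug 𝔤)⟦X⟧) (i j : I) : ℂ⟦X⟧ :=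
  PowerSeries.mk fun n => ρ (coeff n x) i j

/-- The linear functional `x ↦ ρ(x)^i_j` on `U𝔤`. -/
def repEntry (ρ : Ug 𝔤 →ₐ[ℂ] Matrix I I ℂ) (i j : I) : Ug 𝔤 →ₗ[ℂ] ℂ :=
  Matrix.entryLinearMap ℂ ℂ i j ∘ₗ ρ.toLinearMap

namespace Twist

variable (F : Twist 𝔤)

/-- `R^{ij}_{hk} = [(ρ ⊗ ρ)(ℛ)]^{ij}_{hk} = ρ(ℛ⁽¹⁾)^i_h ρ(ℛ⁽²⁾)^j_k`. -/
def Rmatrix (ρ : Ug 𝔤 →ₐ[ℂ] Matrix I I ℂ) (i j h k : I) : ℂ⟦X⟧ :=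
  mapCoeff (LinearMap.mul' ℂ ℂ ∘ₗ TensorProduct.map (repEntry ρ i h) (repEntry ρ j k)) F.universalR

/-- `A^+_i = σ(ℱ⁽¹⁾) a^+_i σ(S(ℱ⁽²⁾) γ)`. -/
def Aplus (κ : Kind) (ρ : Ug 𝔤 →ₐ[ℂ] Matrix I I ℂ) (i : I) : (OscAlg κ I)⟦X⟧ :=
  sandwich
    (sigma₂ κ ρ (mapCoeff (antipodeRight 𝔤) F.series *
      PowerSeries.map (Algebra.TensorProduct.includeRight :
        Ug 𝔤 →ₐ[ℂ] Ug 𝔤 ⊗[ℂ] Ug 𝔤).toRingHom F.gamma))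
    (C (aPlus κ i))

/-- `A^i = σ(γ' S(ℱ⁻¹⁽²⁾)) a^i σ(ℱ⁻¹⁽¹⁾)`. -/
def A (κ : Kind) (ρ : Ug 𝔤 →ₐ[ℂ] Matrix I I ℂ) (i : I) : (OscAlg κ I)⟦X⟧ :=
  sandwich
    (sigma₂ κ ρ (PowerSeries.map (Algebra.TensorProduct.includeLeft :
        Ug 𝔤 →ₐ[ℂ] Ug 𝔤 ⊗[ℂ] Ug 𝔤).toRingHom F.gamma' *
      mapCoeff (antipodeLeft 𝔤 ∘ₗ (flip 𝔤).toLinearMap) F.inv))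
    (C (a κ i))

/-- The adjoint-like action `x ▷_h b = σ(x_(1̄)) b σ(S_h x_(2̄))`,
where `Δ_h(x) = x_(1̄) ⊗ x_(2̄)`. -/
def act (κ : Kind) (ρ : Ug 𝔤 →ₐ[ℂ] Matrix I I ℂ) (x : (Ug 𝔤)⟦X⟧) (b : (OscAlg κ I)⟦X⟧) :
    (OscAlg κ I)⟦X⟧ :=
  sandwich (sigma₂ κ ρ (F.idTensorAntipode (F.comul x))) b

end Twist

/-- The quantum commutation relations with R-matrix `R^{ij}_{hk} = R i j h k`. -/
inductive QuantumRel (κ : Kind) (R : I → I → I → I → ℂ⟦X⟧) :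
    FreeAlgebra ℂ⟦X⟧ (Gen I) → FreeAlgebra ℂ⟦X⟧ (Gen I) → Prop
  | ann_cre (i j : I) : QuantumRel κ R
      (FreeAlgebra.ι ℂ⟦X⟧ (.ann i) * FreeAlgebra.ι ℂ⟦X⟧ (.cre j))
      ((if i = j then 1 else 0) + κ.sign • ∑ u, ∑ v,
        R u i j v • (FreeAlgebra.ι ℂ⟦X⟧ (.cre u) * FreeAlgebra.ι ℂ⟦X⟧ (.ann v)))
  | ann_ann (i j : I) : QuantumRel κ R
      (FreeAlgebra.ι ℂ⟦X⟧ (.ann i) * FreeAlgebra.ι ℂ⟦X⟧ (.ann j))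
      (κ.sign • ∑ u, ∑ v,
        R i j v u • (FreeAlgebra.ι ℂ⟦X⟧ (.ann u) * FreeAlgebra.ι ℂ⟦X⟧ (.ann v)))
  | cre_cre (i j : I) : QuantumRel κ R
      (FreeAlgebra.ι ℂ⟦X⟧ (.cre i) * FreeAlgebra.ι ℂ⟦X⟧ (.cre j))
      (κ.sign • ∑ u, ∑ v,
        R v u i j • (FreeAlgebra.ι ℂ⟦X⟧ (.cre u) * FreeAlgebra.ι ℂ⟦X⟧ (.cre v)))

/-- The deformed Weyl or Clifford algebra `𝒜_h` over `ℂ[[h]]`. -/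
def QuantumAlg (κ : Kind) (R : I → I → I → I → ℂ⟦X⟧) : Type _ := RingQuot (QuantumRel κ R)

instance (κ : Kind) (R : I → I → I → I → ℂ⟦X⟧) : Ring (QuantumAlg κ R) :=
  inferInstanceAs (Ring (RingQuot (QuantumRel κ R)))

instance (κ : Kind) (R : I → I → I → I → ℂ⟦X⟧) : Algebra ℂ⟦X⟧ (QuantumAlg κ R) :=
  inferInstanceAs (Algebra ℂ⟦X⟧ (RingQuot (QuantumRel κ R)))

/-- The generators `Ã^i` and `Ã^+_i` of `𝒜_h`. -/
def QuantumAlg.gen (κ : Kind) (R : I → I → I → I → ℂ⟦X⟧) (g : Gen I) : QuantumAlg κ R :=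
  RingQuot.mkAlgHom ℂ⟦X⟧ (QuantumRel κ R) (FreeAlgebra.ι ℂ⟦X⟧ g)

/-- A deforming map `f : 𝒜_h → 𝒜[[h]]`: an algebra homomorphism over `ℂ[[h]]` which is a formal
change of generators, i.e. sends each generator of `𝒜_h` to the corresponding classical one up to
`O(h)`, and is invertible order by order in `h`, i.e. induces for every `n` a bijection
`𝒜_h / hⁿ𝒜_h → 𝒜[[h]] / hⁿ𝒜[[h]]`. -/
structure IsDeformingMap {κ : Kind} {R : I → I → I → I → ℂ⟦X⟧}
    (f : QuantumAlg κ R →ₐ[ℂ⟦X⟧] (OscAlg κ I)⟦X⟧) : Prop where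
  classical_limit (g : Gen I) :
    constantCoeff (f (QuantumAlg.gen κ R g)) = OscAlg.gen κ g
  injective_mod (n : ℕ) (x : QuantumAlg κ R) (y : (OscAlg κ I)⟦X⟧)
    (h : f x = (X ^ n : ℂ⟦X⟧) • y) : ∃ z, x = (X ^ n : ℂ⟦X⟧) • z
  surjective_mod (n : ℕ) (y : (OscAlg κ I)⟦X⟧) :
    ∃ (x : QuantumAlg κ R) (z : (OscAlg κ I)⟦X⟧), y = f x + (X ^ n : ℂ⟦X⟧) • z

end Twisted

end DeformedCCR
end

set_option maxSynthPendingDepth 6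

noncomputable section

namespace DeformedCCR

open PowerSeries

/-! ## Coefficientwise extension of linear maps -/

section MapCoeff

variable {M N P M' N' P' Q : Type*} [Semiring M] [Algebra ℂ M] [Semiring N] [Algebra ℂ N]
  [Semiring P] [Algebra ℂ P] [Semiring M'] [Algebra ℂ M'] [Semiring N'] [Algebra ℂ N']
  [Semiring P'] [Algebra ℂ P'] [Semiring Q] [Algebra ℂ Q]

/-- Coefficientwise extension of an algebra homomorphism to formal power series. -/
def mapAlg (f : M →ₐ[ℂ] N) : M⟦X⟧ →+* N⟦X⟧ := PowerSeries.map (f : M →+* N)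

@[simp]
theorem coeff_mapCoeff (f : M →ₗ[ℂ] N) (x : M⟦X⟧) (n : ℕ) :
    coeff n (mapCoeff f x) = f (coeff n x) := by
  simp [mapCoeff]

@[simp]
theorem coeff_mapAlg (f : M →ₐ[ℂ] N) (x : M⟦X⟧) (n : ℕ) :
    coeff n (mapAlg f x) = f (coeff n x) := by
  simp [mapAlg]

theorem constantCoeff_mapCoeff (f : M →ₗ[ℂ] N) (x : M⟦X⟧) :
    constantCoeff (mapCoeff f x) = f (constantCoeff x) := by
  rw [← coeff_zero_eq_constantCoeff_apply, coeff_mapCoeff, coeff_zero_eq_constantCoeff_apply]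

theorem constantCoeff_mapAlg (f : M →ₐ[ℂ] N) (x : M⟦X⟧) :
    constantCoeff (mapAlg f x) = f (constantCoeff x) := by
  rw [← coeff_zero_eq_constantCoeff_apply, coeff_mapAlg, coeff_zero_eq_constantCoeff_apply]

theorem mapCoeff_toLinearMap (f : M →ₐ[ℂ] N) (x : M⟦X⟧) :
    mapCoeff f.toLinearMap x = mapAlg f x := by
  ext n; simp

theorem mapCoeff_mapCoeff (g : N →ₗ[ℂ] P) (f : M →ₗ[ℂ] N) (x : M⟦X⟧) :
    mapCoeff g (mapCoeff f x) = mapCoeff (g ∘ₗ f) x := by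
  ext n; simp

theorem mapCoeff_mapAlg (g : N →ₗ[ℂ] P) (f : M →ₐ[ℂ] N) (x : M⟦X⟧) :
    mapCoeff g (mapAlg f x) = mapCoeff (g ∘ₗ f.toLinearMap) x := by
  ext n; simp

theorem mapAlg_mapAlg (g : N →ₐ[ℂ] P) (f : M →ₐ[ℂ] N) (x : M⟦X⟧) :
    mapAlg g (mapAlg f x) = mapAlg (g.comp f) x := by
  ext n; simp

@[simp]
theorem mapAlg_id (x : M⟦X⟧) : mapAlg (AlgHom.id ℂ M) x = x := by
  ext n; simp

theorem mapCoeff_congr {f g : M →ₗ[ℂ] N} (h : ∀ m, f m = g m) (x : M⟦X⟧) :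
    mapCoeff f x = mapCoeff g x := by
  rw [LinearMap.ext h]

theorem mapCoeff_add_left (f g : M →ₗ[ℂ] N) (x : M⟦X⟧) :
    mapCoeff (f + g) x = mapCoeff f x + mapCoeff g x := by
  ext n; simp

theorem mapCoeff_zsmul_left {M N : Type*} [Ring M] [Algebra ℂ M] [Ring N] [Algebra ℂ N]
    (k : ℤ) (f : M →ₗ[ℂ] N) (x : M⟦X⟧) :
    mapCoeff (k • f) x = k • mapCoeff f x := by
  ext n
  simp only [coeff_mapCoeff, LinearMap.smul_apply]
  exact (map_zsmul (coeff n).toAddMonoidHom k (mapCoeff f x)).symm ▸ by simp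

theorem mapCoeff_one {f : M →ₗ[ℂ] N} (h : f 1 = 1) : mapCoeff f 1 = 1 := by
  ext n
  rw [coeff_mapCoeff, coeff_one, coeff_one]
  split <;> simp [h]

/-- An identity between bilinear expressions extends coefficientwise to formal power series. -/
theorem mapCoeff_mul_congr {L : P →ₗ[ℂ] Q} {f : M →ₗ[ℂ] P} {g : N →ₗ[ℂ] P} {L' : P' →ₗ[ℂ] Q}
    {f' : M →ₗ[ℂ] P'} {g' : N →ₗ[ℂ] P'}
    (h : ∀ a b, L (f a * g b) = L' (f' a * g' b)) (x : M⟦X⟧) (y : N⟦X⟧) :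
    mapCoeff L (mapCoeff f x * mapCoeff g y) = mapCoeff L' (mapCoeff f' x * mapCoeff g' y) := by
  ext n
  simp only [coeff_mapCoeff, coeff_mul, map_sum, h]

theorem mapCoeff_mul_congr_swap {L : P →ₗ[ℂ] Q} {f : M →ₗ[ℂ] P} {g : N →ₗ[ℂ] P} {L' : P' →ₗ[ℂ] Q}
    {f' : M →ₗ[ℂ] P'} {g' : N →ₗ[ℂ] P'}
    (h : ∀ a b, L (f a * g b) = L' (g' b * f' a)) (x : M⟦X⟧) (y : N⟦X⟧) :
    mapCoeff L (mapCoeff f x * mapCoeff g y) = mapCoeff L' (mapCoeff g' y * mapCoeff f' x) := by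
  ext n
  simp only [coeff_mapCoeff, coeff_mul, map_sum, h]
  rw [← Finset.Nat.sum_antidiagonal_swap]
  rfl

@[simp]
theorem mapCoeff_id (x : M⟦X⟧) : mapCoeff (LinearMap.id : M →ₗ[ℂ] M) x = x := by
  ext n; simp

/-- `L(f(x) g(y)) = L'(x) L''(y)` for power series. -/
theorem mapCoeff_mul {L : P →ₗ[ℂ] Q} {f : M →ₗ[ℂ] P} {g : N →ₗ[ℂ] P}
    {f' : M →ₗ[ℂ] Q} {g' : N →ₗ[ℂ] Q}
    (h : ∀ a b, L (f a * g b) = f' a * g' b) (x : M⟦X⟧) (y : N⟦X⟧) :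
    mapCoeff L (mapCoeff f x * mapCoeff g y) = mapCoeff f' x * mapCoeff g' y := by
  rw [mapCoeff_mul_congr (L' := LinearMap.id) h, mapCoeff_id]

theorem mapCoeff_mul_swap {L : P →ₗ[ℂ] Q} {f : M →ₗ[ℂ] P} {g : N →ₗ[ℂ] P}
    {f' : M →ₗ[ℂ] Q} {g' : N →ₗ[ℂ] Q}
    (h : ∀ a b, L (f a * g b) = g' b * f' a) (x : M⟦X⟧) (y : N⟦X⟧) :
    mapCoeff L (mapCoeff f x * mapCoeff g y) = mapCoeff g' y * mapCoeff f' x := by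
  rw [mapCoeff_mul_congr_swap (L' := LinearMap.id) h, mapCoeff_id]

end MapCoeff

/-! ## The antipode and the coproduct of `U𝔤` -/

section Hopf

variable {𝔤 : Type*} [LieRing 𝔤] [LieAlgebra ℂ 𝔤]

local notation "H" => Ug 𝔤
local notation "Δ" => Bialgebra.comulAlgHom ℂ (Ug 𝔤)
local notation "ε" => Bialgebra.counitAlgHom ℂ (Ug 𝔤)

variable (𝔤) in
/-- The antipode of `U𝔤`. -/
abbrev anti : Ug 𝔤 →ₗ[ℂ] Ug 𝔤 := HopfAlgebra.antipode ℂ (A := Ug 𝔤)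

theorem anti_mul (x y : H) : anti 𝔤 (x * y) = anti 𝔤 y * anti 𝔤 x :=
  UniversalEnvelopingAlgebra.antipodeLin_mul x y

theorem anti_one : anti 𝔤 1 = 1 := UniversalEnvelopingAlgebra.antipodeLin_one

theorem anti_ι (x : 𝔤) :
    anti 𝔤 (UniversalEnvelopingAlgebra.ι ℂ x) = -UniversalEnvelopingAlgebra.ι ℂ x :=
  UniversalEnvelopingAlgebra.antipodeLin_ι x

theorem comul_ι (x : 𝔤) : Δ (UniversalEnvelopingAlgebra.ι ℂ x) =
    UniversalEnvelopingAlgebra.ι ℂ x ⊗ₜ 1 + 1 ⊗ₜ UniversalEnvelopingAlgebra.ι ℂ x :=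
  UniversalEnvelopingAlgebra.comulHom_ι x

/-- Induction over `U𝔤` as an algebra generated by `𝔤`. -/
theorem Ug.induction {p : H → Prop} (x : H) (hι : ∀ X : 𝔤, p (UniversalEnvelopingAlgebra.ι ℂ X))
    (hscalar : ∀ r : ℂ, p (algebraMap ℂ _ r)) (hadd : ∀ x y, p x → p y → p (x + y))
    (hmul : ∀ x y, p x → p y → p (x * y)) : p x :=
  UniversalEnvelopingAlgebra.mem_of_ι_mem
    { carrier := {x | p x}
      mul_mem' := fun {a b} ha hb => hmul a b ha hb
      add_mem' := fun {a b} ha hb => hadd a b ha hb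
      algebraMap_mem' := hscalar } hι x

theorem anti_algebraMap (r : ℂ) : anti 𝔤 (algebraMap ℂ _ r) = algebraMap ℂ _ r := by
  rw [Algebra.algebraMap_eq_smul_one, map_smul, anti_one]

theorem anti_anti (x : H) : anti 𝔤 (anti 𝔤 x) = x := by
  induction x using Ug.induction with
  | hι X => rw [anti_ι, map_neg, anti_ι, neg_neg]
  | hscalar r => rw [anti_algebraMap, anti_algebraMap]
  | hadd x y hx hy => rw [map_add, map_add, hx, hy]
  | hmul x y hx hy => rw [anti_mul, anti_mul, hx, hy]

variable (𝔤) in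
/-- `x ⊗ y ↦ x S(y)`. -/
def mulAnti : H ⊗[ℂ] H →ₗ[ℂ] H := LinearMap.mul' ℂ H ∘ₗ antipodeRight 𝔤

variable (𝔤) in
/-- `x ⊗ y ↦ S(x) y`. -/
def antiMul : H ⊗[ℂ] H →ₗ[ℂ] H := LinearMap.mul' ℂ H ∘ₗ antipodeLeft 𝔤

@[simp] theorem mulAnti_tmul (x y : H) : mulAnti 𝔤 (x ⊗ₜ y) = x * anti 𝔤 y := rfl

@[simp] theorem antiMul_tmul (x y : H) : antiMul 𝔤 (x ⊗ₜ y) = anti 𝔤 x * y := rfl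

theorem mulAnti_comul (x : H) : mulAnti 𝔤 (Δ x) = algebraMap ℂ H (ε x) :=
  UniversalEnvelopingAlgebra.antipode_right x

theorem antiMul_comul (x : H) : antiMul 𝔤 (Δ x) = algebraMap ℂ H (ε x) :=
  UniversalEnvelopingAlgebra.antipode_left x

variable (𝔤) in
/-- `S ⊗ S`. -/
def anti₂ : H ⊗[ℂ] H →ₗ[ℂ] H ⊗[ℂ] H := TensorProduct.map (anti 𝔤) (anti 𝔤)

@[simp] theorem anti₂_tmul (x y : H) : anti₂ 𝔤 (x ⊗ₜ y) = anti 𝔤 x ⊗ₜ anti 𝔤 y := rfl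

theorem anti₂_mul (s t : H ⊗[ℂ] H) : anti₂ 𝔤 (s * t) = anti₂ 𝔤 t * anti₂ 𝔤 s := by
  induction s with
  | zero => simp
  | add s s' hs hs' => simp only [add_mul, mul_add, map_add, hs, hs']
  | tmul x y =>
    induction t with
    | zero => simp
    | add t t' ht ht' => simp only [add_mul, mul_add, map_add, ht, ht']
    | tmul z w => simp [anti_mul]

theorem comul_anti (x : H) : Δ (anti 𝔤 x) = anti₂ 𝔤 (Δ x) := by
  induction x using Ug.induction with
  | hι X =>
    rw [anti_ι, map_neg, comul_ι, map_add, anti₂_tmul, anti₂_tmul, anti_ι, anti_one,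
      TensorProduct.neg_tmul, TensorProduct.tmul_neg, neg_add]
  | hscalar r =>
    rw [anti_algebraMap, AlgHom.commutes, Algebra.algebraMap_eq_smul_one, map_smul,
      Algebra.TensorProduct.one_def, anti₂_tmul, anti_one]
  | hadd x y hx hy => simp only [map_add, hx, hy]
  | hmul x y hx hy => rw [anti_mul, map_mul, map_mul, anti₂_mul, hx, hy]

/-- Algebra homomorphisms out of `U𝔤 ⊗ A` agree as soon as they agree on `𝔤 ⊗ 1` and `1 ⊗ A`. -/
theorem tensor_algHom_ext {A B : Type*} [Semiring A] [Algebra ℂ A] [Semiring B] [Algebra ℂ B]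
    {f g : H ⊗[ℂ] A →ₐ[ℂ] B}
    (h₁ : ∀ X : 𝔤, f (UniversalEnvelopingAlgebra.ι ℂ X ⊗ₜ 1) =
      g (UniversalEnvelopingAlgebra.ι ℂ X ⊗ₜ 1))
    (h₂ : f.comp Algebra.TensorProduct.includeRight =
      g.comp Algebra.TensorProduct.includeRight) : f = g :=
  Algebra.TensorProduct.ext (UniversalEnvelopingAlgebra.algHom_ext_ι h₁) h₂

theorem tensor₂_algHom_ext {B : Type*} [Semiring B] [Algebra ℂ B]
    {f g : H ⊗[ℂ] H →ₐ[ℂ] B}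
    (h₁ : ∀ X : 𝔤, f (UniversalEnvelopingAlgebra.ι ℂ X ⊗ₜ 1) =
      g (UniversalEnvelopingAlgebra.ι ℂ X ⊗ₜ 1))
    (h₂ : ∀ X : 𝔤, f (1 ⊗ₜ UniversalEnvelopingAlgebra.ι ℂ X) =
      g (1 ⊗ₜ UniversalEnvelopingAlgebra.ι ℂ X)) : f = g :=
  tensor_algHom_ext h₁ (UniversalEnvelopingAlgebra.algHom_ext_ι h₂)

@[simp] theorem flip_tmul (x y : H) : flip 𝔤 (x ⊗ₜ y) = y ⊗ₜ x := rfl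

@[simp] theorem flip_flip (t : H ⊗[ℂ] H) : flip 𝔤 (flip 𝔤 t) = t := by
  have : (flip 𝔤).comp (flip 𝔤) = AlgHom.id ℂ _ := tensor₂_algHom_ext (by simp) (by simp)
  exact DFunLike.congr_fun this t

theorem flip_comul (x : H) : flip 𝔤 (Δ x) = Δ x := by
  have : (flip 𝔤).comp Δ = Δ := by
    refine UniversalEnvelopingAlgebra.algHom_ext_ι fun X => ?_
    rw [AlgHom.comp_apply, comul_ι, map_add, flip_tmul, flip_tmul, add_comm]
  exact DFunLike.congr_fun this x

@[simp] theorem leg12_tmul (x y : H) : leg12 𝔤 (x ⊗ₜ y) = x ⊗ₜ (y ⊗ₜ 1) := rfl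

@[simp] theorem leg23_apply (t : H ⊗[ℂ] H) : leg23 𝔤 t = 1 ⊗ₜ t := rfl

@[simp] theorem comulRight_tmul (x y : H) : comulRight 𝔤 (x ⊗ₜ y) = x ⊗ₜ Δ y := rfl

theorem comulLeft_tmul (x y : H) :
    comulLeft 𝔤 (x ⊗ₜ y) = Algebra.TensorProduct.assoc ℂ ℂ ℂ H H H (Δ x ⊗ₜ y) := rfl

@[simp] theorem counitLeft_tmul (x y : H) : counitLeft 𝔤 (x ⊗ₜ y) = ε x • y := rfl

@[simp] theorem counitRight_tmul (x y : H) : counitRight 𝔤 (x ⊗ₜ y) = ε y • x := rfl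

variable (𝔤) in
/-- The flip of the first two legs. -/
def flip12 : H ⊗[ℂ] (H ⊗[ℂ] H) →ₐ[ℂ] H ⊗[ℂ] (H ⊗[ℂ] H) :=
  (Algebra.TensorProduct.leftComm ℂ H H H).toAlgHom

variable (𝔤) in
/-- The flip of the last two legs. -/
def flip23 : H ⊗[ℂ] (H ⊗[ℂ] H) →ₐ[ℂ] H ⊗[ℂ] (H ⊗[ℂ] H) :=
  Algebra.TensorProduct.map (AlgHom.id ℂ H) (flip 𝔤)

@[simp] theorem flip12_tmul (x y z : H) :
    flip12 𝔤 (x ⊗ₜ (y ⊗ₜ z)) = y ⊗ₜ (x ⊗ₜ z) := rfl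

@[simp] theorem flip23_tmul (x : H) (t : H ⊗[ℂ] H) : flip23 𝔤 (x ⊗ₜ t) = x ⊗ₜ flip 𝔤 t := rfl

theorem flip12_comp_comulLeft : (flip12 𝔤).comp (comulLeft 𝔤) = comulLeft 𝔤 := by
  refine tensor₂_algHom_ext (fun X => ?_) fun X => ?_
  · simp only [AlgHom.comp_apply, comulLeft_tmul, comul_ι, TensorProduct.add_tmul, map_add,
      Algebra.TensorProduct.assoc_tmul, flip12_tmul, add_comm]
  · simp only [AlgHom.comp_apply, comulLeft_tmul, map_one, Algebra.TensorProduct.one_def,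
      Algebra.TensorProduct.assoc_tmul, flip12_tmul]

theorem flip23_comp_comulRight : (flip23 𝔤).comp (comulRight 𝔤) = comulRight 𝔤 := by
  refine tensor₂_algHom_ext (fun X => ?_) fun X => ?_
  · simp [map_one, Algebra.TensorProduct.one_def]
  · rw [AlgHom.comp_apply, comulRight_tmul, flip23_tmul, flip_comul]

variable (𝔤) in
/-- The cyclic permutation `x ⊗ y ⊗ z ↦ z ⊗ x ⊗ y`. -/
def cycle : H ⊗[ℂ] (H ⊗[ℂ] H) →ₐ[ℂ] H ⊗[ℂ] (H ⊗[ℂ] H) := (flip12 𝔤).comp (flip23 𝔤)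

@[simp] theorem cycle_tmul (x y z : H) : cycle 𝔤 (x ⊗ₜ (y ⊗ₜ z)) = z ⊗ₜ (x ⊗ₜ y) := rfl

/-- `ℱ_{23,1}`. -/
theorem cycle_comp_comulLeft :
    (cycle 𝔤).comp (comulLeft 𝔤) = (comulRight 𝔤).comp (flip 𝔤) := by
  refine tensor₂_algHom_ext (fun X => ?_) fun X => ?_
  · simp only [AlgHom.comp_apply, comulLeft_tmul, comul_ι, TensorProduct.add_tmul, map_add,
      Algebra.TensorProduct.assoc_tmul, cycle_tmul, flip_tmul, comulRight_tmul,
      TensorProduct.tmul_add]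
  · simp only [AlgHom.comp_apply, comulLeft_tmul, map_one, Algebra.TensorProduct.one_def,
      Algebra.TensorProduct.assoc_tmul, cycle_tmul, flip_tmul, comulRight_tmul]

/-- `ℱ_{2,13}`. -/
theorem cycle_comp_comulRight :
    (cycle 𝔤).comp (comulRight 𝔤) = (flip12 𝔤).comp (comulRight 𝔤) := by
  rw [cycle, AlgHom.comp_assoc, flip23_comp_comulRight]

variable (𝔤) in
/-- The reversal `x ⊗ y ⊗ z ↦ z ⊗ y ⊗ x`. -/
def reverse : H ⊗[ℂ] (H ⊗[ℂ] H) →ₐ[ℂ] H ⊗[ℂ] (H ⊗[ℂ] H) := (cycle 𝔤).comp (flip12 𝔤)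

@[simp] theorem reverse_tmul (x y z : H) : reverse 𝔤 (x ⊗ₜ (y ⊗ₜ z)) = z ⊗ₜ (y ⊗ₜ x) := rfl

theorem reverse_comp_comulLeft :
    (reverse 𝔤).comp (comulLeft 𝔤) = (comulRight 𝔤).comp (flip 𝔤) := by
  rw [reverse, AlgHom.comp_assoc, flip12_comp_comulLeft, cycle_comp_comulLeft]

theorem reverse_comp_comulRight :
    (reverse 𝔤).comp (comulRight 𝔤) = (comulLeft 𝔤).comp (flip 𝔤) := by
  refine tensor₂_algHom_ext (fun X => ?_) fun X => ?_
  · simp only [AlgHom.comp_apply, comulLeft_tmul, map_one, Algebra.TensorProduct.one_def,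
      Algebra.TensorProduct.assoc_tmul, reverse_tmul, flip_tmul, comulRight_tmul]
  · simp only [AlgHom.comp_apply, comulLeft_tmul, comul_ι, TensorProduct.add_tmul, map_add,
      Algebra.TensorProduct.assoc_tmul, reverse_tmul, flip_tmul, comulRight_tmul,
      TensorProduct.tmul_add, add_comm]

theorem reverse_comp_leg12 : (reverse 𝔤).comp (leg12 𝔤) = (leg23 𝔤).comp (flip 𝔤) :=
  tensor₂_algHom_ext (by simp) (by simp)

theorem reverse_comp_leg23 : (reverse 𝔤).comp (leg23 𝔤) = (leg12 𝔤).comp (flip 𝔤) :=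
  tensor₂_algHom_ext (by simp) (by simp)

theorem counitLeft_comp_flip : (counitLeft 𝔤).comp (flip 𝔤) = counitRight 𝔤 :=
  tensor₂_algHom_ext (by simp) (by simp)

theorem counitRight_comp_flip : (counitRight 𝔤).comp (flip 𝔤) = counitLeft 𝔤 :=
  tensor₂_algHom_ext (by simp) (by simp)

end Hopf

/-! ## Contractions of tensor legs -/

section Contractions

variable {𝔤 : Type*} [LieRing 𝔤] [LieAlgebra ℂ 𝔤]

local notation "H" => Ug 𝔤
local notation "Δ" => Bialgebra.comulAlgHom ℂ (Ug 𝔤)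
local notation "ε" => Bialgebra.counitAlgHom ℂ (Ug 𝔤)

variable (𝔤) in
/-- `x ↦ x ⊗ 1`. -/
abbrev inl : H →ₐ[ℂ] H ⊗[ℂ] H := Algebra.TensorProduct.includeLeft

variable (𝔤) in
/-- `y ↦ 1 ⊗ y`. -/
abbrev inr : H →ₐ[ℂ] H ⊗[ℂ] H := Algebra.TensorProduct.includeRight

theorem mulAnti_tmul_mul (x y : H) (w : H ⊗[ℂ] H) :
    mulAnti 𝔤 (x ⊗ₜ y * w) = x * mulAnti 𝔤 w * anti 𝔤 y := by
  induction w with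
  | zero => simp
  | add s t hs ht => simp only [mul_add, add_mul, map_add, hs, ht]
  | tmul z w => simp [anti_mul, mul_assoc]

theorem antiMul_mul_tmul (x y : H) (w : H ⊗[ℂ] H) :
    antiMul 𝔤 (w * x ⊗ₜ y) = anti 𝔤 x * antiMul 𝔤 w * y := by
  induction w with
  | zero => simp
  | add s t hs ht => simp only [mul_add, add_mul, map_add, hs, ht]
  | tmul z w => simp [anti_mul, mul_assoc]

variable (𝔤) in
/-- `x ⊗ y ⊗ z ↦ x ⊗ y S(z)`. -/
def contract23 : H ⊗[ℂ] (H ⊗[ℂ] H) →ₗ[ℂ] H ⊗[ℂ] H := (mulAnti 𝔤).lTensor H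

@[simp] theorem contract23_tmul (x : H) (t : H ⊗[ℂ] H) :
    contract23 𝔤 (x ⊗ₜ t) = x ⊗ₜ mulAnti 𝔤 t := rfl

theorem contract23_leg12_mul (s : H ⊗[ℂ] H) (t : H ⊗[ℂ] (H ⊗[ℂ] H)) :
    contract23 𝔤 (leg12 𝔤 s * t) = s * contract23 𝔤 t := by
  induction s with
  | zero => simp
  | add s s' h h' => simp only [add_mul, map_add, h, h']
  | tmul x y =>
    induction t with
    | zero => simp
    | add s s' h h' => simp only [mul_add, map_add, h, h']
    | tmul z w => simp [mulAnti_tmul_mul]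

theorem contract23_mul_comulRight (t : H ⊗[ℂ] (H ⊗[ℂ] H)) (s : H ⊗[ℂ] H) :
    contract23 𝔤 (t * comulRight 𝔤 s) =
      contract23 𝔤 (t * (leg12 𝔤).comp ((inl 𝔤).comp (counitRight 𝔤)) s) := by
  induction s with
  | zero => simp
  | add s s' h h' => simp only [mul_add, map_add, h, h']
  | tmul x y =>
    induction t with
    | zero => simp
    | add s s' h h' => simp only [add_mul, map_add, h, h']
    | tmul z w =>
      induction w with
      | zero => simp
      | add s s' h h' => simp only [TensorProduct.tmul_add, add_mul, map_add, h, h']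
      | tmul p q =>
        rw [comulRight_tmul, Algebra.TensorProduct.tmul_mul_tmul, contract23_tmul,
          mulAnti_tmul_mul, mulAnti_comul]
        simp [Algebra.algebraMap_eq_smul_one]

theorem contract23_leg13_mul_leg23 (s w : H ⊗[ℂ] H) :
    contract23 𝔤 ((flip12 𝔤).comp (leg23 𝔤) s * leg23 𝔤 w) =
      (inr 𝔤).toLinearMap (mulAnti 𝔤 w) * antipodeRight 𝔤 s := by
  induction s with
  | zero => simp
  | add s s' h h' => simp only [mul_add, add_mul, map_add, h, h']
  | tmul x y =>
    induction w with
    | zero => simp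
    | add s s' h h' => simp only [mul_add, add_mul, map_add, h, h']
    | tmul z w => simp [antipodeRight, anti_mul, mul_assoc]

variable (𝔤) in
/-- `x ⊗ y ⊗ z ↦ x S(y) z`. -/
def contractAll : H ⊗[ℂ] (H ⊗[ℂ] H) →ₗ[ℂ] H :=
  LinearMap.mul' ℂ H ∘ₗ (antiMul 𝔤).lTensor H

@[simp] theorem contractAll_tmul (x : H) (t : H ⊗[ℂ] H) :
    contractAll 𝔤 (x ⊗ₜ t) = x * antiMul 𝔤 t := rfl

theorem contractAll_leg23_mul_leg12 (s t : H ⊗[ℂ] H) :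
    contractAll 𝔤 (leg23 𝔤 s * leg12 𝔤 t) = mulAnti 𝔤 t * antiMul 𝔤 s := by
  induction s with
  | zero => simp
  | add s s' h h' => simp only [mul_add, add_mul, map_add, h, h']
  | tmul x y =>
    induction t with
    | zero => simp
    | add s s' h h' => simp only [mul_add, add_mul, map_add, h, h']
    | tmul z w => simp [anti_mul, mul_assoc]

theorem contractAll_comulRight_mul_comulLeft (s t : H ⊗[ℂ] H) :
    contractAll 𝔤 (comulRight 𝔤 s * comulLeft 𝔤 t) = counitRight 𝔤 s * counitLeft 𝔤 t := by
  induction s with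
  | zero => simp
  | add s s' h h' => simp only [add_mul, map_add, h, h']
  | tmul x y =>
    induction t with
    | zero => simp
    | add s s' h h' => simp only [mul_add, map_add, h, h']
    | tmul z w =>
      have key : ∀ p : H ⊗[ℂ] H, contractAll 𝔤 (x ⊗ₜ Δ y *
          Algebra.TensorProduct.assoc ℂ ℂ ℂ H H H (p ⊗ₜ w)) = ε y • (x * mulAnti 𝔤 p * w) := by
        intro p
        induction p with
        | zero => simp
        | add s s' h h' => simp only [TensorProduct.add_tmul, mul_add, add_mul, map_add, h, h',
            smul_add]
        | tmul a b =>
          rw [Algebra.TensorProduct.assoc_tmul, Algebra.TensorProduct.tmul_mul_tmul,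
            contractAll_tmul, antiMul_mul_tmul, antiMul_comul]
          simp [Algebra.algebraMap_eq_smul_one, mul_assoc]
      rw [comulRight_tmul, comulLeft_tmul, key, mulAnti_comul]
      simp [Algebra.algebraMap_eq_smul_one, smul_smul, mul_comm]

/-! ### Four legs -/

variable (𝔤) in
/-- `x ⊗ y ⊗ z ⊗ w ↦ x S(w) ⊗ y S(z)`. -/
def nest : H ⊗[ℂ] (H ⊗[ℂ] (H ⊗[ℂ] H)) →ₗ[ℂ] H ⊗[ℂ] H :=
  TensorProduct.map (mulAnti 𝔤) (mulAnti 𝔤) ∘ₗ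
    (TensorProduct.assoc ℂ H H (H ⊗[ℂ] H)).symm.toLinearMap ∘ₗ
      ((TensorProduct.comm ℂ (H ⊗[ℂ] H) H).toLinearMap ∘ₗ
        (TensorProduct.assoc ℂ H H H).symm.toLinearMap).lTensor H

@[simp] theorem nest_tmul (x y z w : H) :
    nest 𝔤 (x ⊗ₜ (y ⊗ₜ (z ⊗ₜ w))) = (x * anti 𝔤 w) ⊗ₜ (y * anti 𝔤 z) := rfl

/-- Induction over `H ⊗ H ⊗ H`. -/
theorem tensor₃_induction {A B C : Type*} [Ring A] [Algebra ℂ A] [Ring B] [Algebra ℂ B]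
    [Ring C] [Algebra ℂ C] {p : A ⊗[ℂ] (B ⊗[ℂ] C) → Prop} (t : A ⊗[ℂ] (B ⊗[ℂ] C))
    (zero : p 0) (add : ∀ s t, p s → p t → p (s + t))
    (tmul : ∀ x y z, p (x ⊗ₜ (y ⊗ₜ z))) : p t := by
  induction t with
  | zero => exact zero
  | add s t hs ht => exact add s t hs ht
  | tmul x t =>
    induction t with
    | zero => rw [TensorProduct.tmul_zero]; exact zero
    | add s t hs ht => rw [TensorProduct.tmul_add]; exact add _ _ hs ht
    | tmul y z => exact tmul x y z

/-- Induction over `H ⊗ H ⊗ H ⊗ H`. -/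
theorem tensor₄_induction {p : H ⊗[ℂ] (H ⊗[ℂ] (H ⊗[ℂ] H)) → Prop}
    (t : H ⊗[ℂ] (H ⊗[ℂ] (H ⊗[ℂ] H)))
    (zero : p 0) (add : ∀ s t, p s → p t → p (s + t))
    (tmul : ∀ x y z w, p (x ⊗ₜ (y ⊗ₜ (z ⊗ₜ w)))) : p t := by
  induction t using tensor₃_induction with
  | zero => exact zero
  | add s t hs ht => exact add s t hs ht
  | tmul x y t =>
    induction t with
    | zero => rw [TensorProduct.tmul_zero, TensorProduct.tmul_zero]; exact zero
    | add s t hs ht => rw [TensorProduct.tmul_add, TensorProduct.tmul_add]; exact add _ _ hs ht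
    | tmul z w => exact tmul x y z w

variable (𝔤) in
/-- `id ⊗ id ⊗ Δ`. -/
def comul3 : H ⊗[ℂ] (H ⊗[ℂ] H) →ₐ[ℂ] H ⊗[ℂ] (H ⊗[ℂ] (H ⊗[ℂ] H)) :=
  Algebra.TensorProduct.map (AlgHom.id ℂ H) (comulRight 𝔤)

variable (𝔤) in
/-- `id ⊗ Δ ⊗ id`. -/
def comul2 : H ⊗[ℂ] (H ⊗[ℂ] H) →ₐ[ℂ] H ⊗[ℂ] (H ⊗[ℂ] (H ⊗[ℂ] H)) :=
  Algebra.TensorProduct.map (AlgHom.id ℂ H) (comulLeft 𝔤)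

variable (𝔤) in
/-- `t ↦ 1 ⊗ t`. -/
def leg234 : H ⊗[ℂ] (H ⊗[ℂ] H) →ₐ[ℂ] H ⊗[ℂ] (H ⊗[ℂ] (H ⊗[ℂ] H)) :=
  Algebra.TensorProduct.includeRight

variable (𝔤) in
/-- `x ⊗ y ↦ x ⊗ 1 ⊗ 1 ⊗ y`. -/
def leg14 : H ⊗[ℂ] H →ₐ[ℂ] H ⊗[ℂ] (H ⊗[ℂ] (H ⊗[ℂ] H)) :=
  Algebra.TensorProduct.map (AlgHom.id ℂ H) ((leg23 𝔤).comp (inr 𝔤))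

variable (𝔤) in
/-- `id ⊗ ε ⊗ id`. -/
def counit2 : H ⊗[ℂ] (H ⊗[ℂ] H) →ₐ[ℂ] H ⊗[ℂ] H :=
  Algebra.TensorProduct.map (AlgHom.id ℂ H) (counitLeft 𝔤)

@[simp] theorem comul3_tmul (x : H) (t : H ⊗[ℂ] H) :
    comul3 𝔤 (x ⊗ₜ t) = x ⊗ₜ comulRight 𝔤 t := rfl

@[simp] theorem comul2_tmul (x : H) (t : H ⊗[ℂ] H) :
    comul2 𝔤 (x ⊗ₜ t) = x ⊗ₜ comulLeft 𝔤 t := rfl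

@[simp] theorem leg234_apply (t : H ⊗[ℂ] (H ⊗[ℂ] H)) : leg234 𝔤 t = 1 ⊗ₜ t := rfl

@[simp] theorem leg14_tmul (x y : H) : leg14 𝔤 (x ⊗ₜ y) = x ⊗ₜ (1 ⊗ₜ (1 ⊗ₜ y)) := rfl

@[simp] theorem counit2_tmul (x : H) (t : H ⊗[ℂ] H) :
    counit2 𝔤 (x ⊗ₜ t) = x ⊗ₜ counitLeft 𝔤 t := rfl

theorem comul3_comp_leg23 : (comul3 𝔤).comp (leg23 𝔤) = (leg234 𝔤).comp (comulRight 𝔤) :=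
  rfl

theorem comul2_comp_leg23 : (comul2 𝔤).comp (leg23 𝔤) = (leg234 𝔤).comp (comulLeft 𝔤) :=
  rfl

theorem comulLeft_comul (x : H) : comulLeft 𝔤 (Δ x) = comulRight 𝔤 (Δ x) :=
  Coalgebra.coassoc_apply (R := ℂ) x

theorem comul2_comp_comulRight :
    (comul2 𝔤).comp (comulRight 𝔤) = (comul3 𝔤).comp (comulRight 𝔤) := by
  refine Algebra.TensorProduct.ext' fun x y => ?_
  simp only [AlgHom.comp_apply, comulRight_tmul, comul2_tmul, comul3_tmul, comulLeft_comul]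

theorem counit2_comp_leg23 :
    (counit2 𝔤).comp (leg23 𝔤) = (inr 𝔤).comp (counitLeft 𝔤) :=
  rfl

theorem counit2_comp_comulRight : (counit2 𝔤).comp (comulRight 𝔤) = AlgHom.id ℂ _ := by
  refine Algebra.TensorProduct.ext' fun x y => ?_
  have h : counitLeft 𝔤 (Δ y) = y := by
    have := congrArg (TensorProduct.lid ℂ H) (Coalgebra.rTensor_counit_comul (R := ℂ) y)
    rw [TensorProduct.lid_tmul, one_smul] at this
    exact this
  rw [AlgHom.comp_apply, comulRight_tmul, counit2_tmul, h, AlgHom.id_apply]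

theorem nest_leg12_mul (s : H ⊗[ℂ] H) (t : H ⊗[ℂ] (H ⊗[ℂ] (H ⊗[ℂ] H))) :
    nest 𝔤 ((comul3 𝔤).comp (leg12 𝔤) s * t) = s * nest 𝔤 t := by
  induction s with
  | zero => simp
  | add s s' h h' => simp only [add_mul, map_add, h, h']
  | tmul a b =>
    induction t using tensor₄_induction with
    | zero => simp
    | add s s' h h' => simp only [mul_add, map_add, h, h']
    | tmul x y z w => simp [map_one, Algebra.TensorProduct.one_def, mul_assoc]

theorem nest_mul_comul2 (t : H ⊗[ℂ] (H ⊗[ℂ] (H ⊗[ℂ] H))) (s : H ⊗[ℂ] (H ⊗[ℂ] H)) :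
    nest 𝔤 (t * comul2 𝔤 s) = nest 𝔤 (t * (leg14 𝔤).comp (counit2 𝔤) s) := by
  induction t using tensor₄_induction with
  | zero => simp
  | add s s' h h' => simp only [add_mul, map_add, h, h']
  | tmul x y z w =>
    induction s using tensor₃_induction with
    | zero => simp
    | add s s' h h' => simp only [mul_add, map_add, h, h']
    | tmul a b c =>
      have key : ∀ p : H ⊗[ℂ] H, nest 𝔤 (x ⊗ₜ (y ⊗ₜ (z ⊗ₜ w)) *
          a ⊗ₜ (Algebra.TensorProduct.assoc ℂ ℂ ℂ H H H (p ⊗ₜ c))) =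
          (x * a * anti 𝔤 (w * c)) ⊗ₜ (y * mulAnti 𝔤 p * anti 𝔤 z) := by
        intro p
        induction p with
        | zero => simp
        | add s s' h h' => simp only [TensorProduct.add_tmul, TensorProduct.tmul_add, mul_add,
            add_mul, map_add, h, h']
        | tmul p q => simp [anti_mul, mul_assoc]
      rw [comul2_tmul, comulLeft_tmul, key, mulAnti_comul]
      simp [Algebra.algebraMap_eq_smul_one]

theorem nest_leg34_mul (r : H ⊗[ℂ] H) (t : H ⊗[ℂ] (H ⊗[ℂ] (H ⊗[ℂ] H))) :
    nest 𝔤 ((leg234 𝔤).comp (leg23 𝔤) r * t) = nest 𝔤 t * anti₂ 𝔤 (flip 𝔤 r) := by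
  induction r with
  | zero => simp
  | add s s' h h' => simp only [mul_add, add_mul, map_add, h, h']
  | tmul a b =>
    induction t using tensor₄_induction with
    | zero => simp
    | add s s' h h' => simp only [mul_add, add_mul, map_add, h, h']
    | tmul x y z w => simp [anti_mul, mul_assoc]

theorem nest_leg23_mul_leg14 (s t : H ⊗[ℂ] H) :
    nest 𝔤 ((leg234 𝔤).comp (leg12 𝔤) s * leg14 𝔤 t) =
      inl 𝔤 (mulAnti 𝔤 t) * inr 𝔤 (mulAnti 𝔤 s) := by
  induction s with
  | zero => simp
  | add s s' h h' => simp only [mul_add, add_mul, map_add, h, h']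
  | tmul a b =>
    induction t with
    | zero => simp
    | add s s' h h' => simp only [mul_add, add_mul, map_add, h, h']
    | tmul x y => simp

theorem comul_mulAnti (t : H ⊗[ℂ] H) :
    Δ (mulAnti 𝔤 t) = nest 𝔤 ((comul3 𝔤).comp (comulLeft 𝔤) t) := by
  induction t with
  | zero => simp
  | add s s' h h' => simp only [map_add, h, h']
  | tmul x y =>
    have key : ∀ p q : H ⊗[ℂ] H, nest 𝔤 (TensorProduct.assoc ℂ H H (H ⊗[ℂ] H) (p ⊗ₜ q)) =
        p * anti₂ 𝔤 (flip 𝔤 q) := by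
      intro p q
      induction p with
      | zero => simp
      | add s s' h h' => simp only [TensorProduct.add_tmul, map_add, add_mul, h, h']
      | tmul a b =>
        induction q with
        | zero => simp
        | add s s' h h' => simp only [TensorProduct.tmul_add, map_add, mul_add, h, h']
        | tmul c d => simp
    have h : ∀ p : H ⊗[ℂ] H, comul3 𝔤 (Algebra.TensorProduct.assoc ℂ ℂ ℂ H H H (p ⊗ₜ y)) =
        TensorProduct.assoc ℂ H H (H ⊗[ℂ] H) (p ⊗ₜ Δ y) := by
      intro p
      induction p with
      | zero => simp
      | add s s' h h' => simp only [TensorProduct.add_tmul, map_add, h, h']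
      | tmul a b => rfl
    rw [AlgHom.comp_apply, comulLeft_tmul, h, key, flip_comul, mulAnti_tmul, map_mul, comul_anti]

end Contractions

/-! ## Identities for cocycle twists -/

namespace Twist

variable {𝔤 : Type*} [LieRing 𝔤] [LieAlgebra ℂ 𝔤] (F : Twist 𝔤)

local notation "H" => Ug 𝔤
local notation "Δ" => Bialgebra.comulAlgHom ℂ (Ug 𝔤)

theorem inv_eq_of_mul {t : (H ⊗[ℂ] H)⟦X⟧} (h : t * F.series = 1) : F.inv = t :=
  (left_inv_eq_right_inv h F.mul_inv).symm

theorem map_mul_inv {A : Type*} [Semiring A] [Algebra ℂ A] (f : H ⊗[ℂ] H →ₐ[ℂ] A) :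
    mapAlg f F.series * mapAlg f F.inv = 1 := by
  rw [← map_mul, F.mul_inv, map_one]

theorem map_inv_mul {A : Type*} [Semiring A] [Algebra ℂ A] (f : H ⊗[ℂ] H →ₐ[ℂ] A) :
    mapAlg f F.inv * mapAlg f F.series = 1 := by
  rw [← map_mul, F.inv_mul, map_one]

theorem counitLeft_series : mapAlg (counitLeft 𝔤) F.series = 1 := F.counit_left

theorem counitRight_series : mapAlg (counitRight 𝔤) F.series = 1 := F.counit_right

theorem counitLeft_inv : mapAlg (counitLeft 𝔤) F.inv = 1 := by
  have := F.map_inv_mul (counitLeft 𝔤)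
  rwa [F.counitLeft_series, mul_one] at this

/-- The twist `ℱ₂₁`. -/
def swap : Twist 𝔤 where
  series := mapAlg (flip 𝔤) F.series
  counit_left := by
    change mapAlg (counitLeft 𝔤) _ = 1
    rw [mapAlg_mapAlg, counitLeft_comp_flip, F.counitRight_series]
  counit_right := by
    change mapAlg (counitRight 𝔤) _ = 1
    rw [mapAlg_mapAlg, counitRight_comp_flip, F.counitLeft_series]
  constantCoeff_eq := by
    rw [constantCoeff_mapAlg, F.constantCoeff_eq, map_one]

theorem swap_series : F.swap.series = mapAlg (flip 𝔤) F.series := rfl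

theorem swap_inv : F.swap.inv = mapAlg (flip 𝔤) F.inv :=
  F.swap.inv_eq_of_mul (F.map_inv_mul _)

theorem flip_flip_series (t : (H ⊗[ℂ] H)⟦X⟧) : mapAlg (flip 𝔤) (mapAlg (flip 𝔤) t) = t := by
  ext n; simp

theorem gammaInv_eq : F.gammaInv = mapCoeff (mulAnti 𝔤) F.series := rfl

theorem gamma_eq : F.gamma = mapCoeff (antiMul 𝔤) F.inv := rfl

theorem gamma'_eq : F.gamma' = F.swap.gammaInv := by
  rw [gammaInv_eq, swap_series, mapCoeff_mapAlg]
  rfl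

/-- Coefficientwise antipode. -/
abbrev antiSeries (x : H⟦X⟧) : H⟦X⟧ := mapCoeff (anti 𝔤) x

theorem antiSeries_mul (x y : H⟦X⟧) : antiSeries (x * y) = antiSeries y * antiSeries x := by
  simpa only [mapCoeff_id] using mapCoeff_mul_swap (f := LinearMap.id) (g := LinearMap.id)
    (fun a b => anti_mul (𝔤 := 𝔤) a b) x y

theorem antiSeries_one : antiSeries (1 : H⟦X⟧) = 1 := mapCoeff_one anti_one

theorem antiSeries_antiSeries (x : H⟦X⟧) : antiSeries (antiSeries x) = x := by
  ext n; simp only [coeff_mapCoeff, anti_anti]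

theorem anti₂_series_mul (s t : (H ⊗[ℂ] H)⟦X⟧) :
    mapCoeff (anti₂ 𝔤) (s * t) = mapCoeff (anti₂ 𝔤) t * mapCoeff (anti₂ 𝔤) s := by
  simpa only [mapCoeff_id] using mapCoeff_mul_swap (f := LinearMap.id) (g := LinearMap.id)
    (fun a b => anti₂_mul (𝔤 := 𝔤) a b) s t

theorem antiSeries_gammaInv : antiSeries F.gammaInv = F.gamma' := by
  rw [gamma'_eq, gammaInv_eq, gammaInv_eq, swap_series, mapCoeff_mapAlg, antiSeries,
    mapCoeff_mapCoeff]
  refine mapCoeff_congr (fun t => ?_) _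
  induction t with
  | zero => simp
  | add s t hs ht => rw [map_add, map_add, hs, ht]
  | tmul x y => simp [anti_mul, anti_anti]

theorem antiSeries_gamma' : antiSeries F.gamma' = F.gammaInv := by
  rw [← antiSeries_gammaInv, antiSeries_antiSeries]

variable {F}

theorem IsCocycle.eq (hF : F.IsCocycle) :
    mapAlg (leg12 𝔤) F.series * mapAlg (comulLeft 𝔤) F.series =
      mapAlg (leg23 𝔤) F.series * mapAlg (comulRight 𝔤) F.series := hF

theorem IsCocycle.comulLeft_eq (hF : F.IsCocycle) : mapAlg (comulLeft 𝔤) F.series =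
    mapAlg (leg12 𝔤) F.inv * (mapAlg (leg23 𝔤) F.series * mapAlg (comulRight 𝔤) F.series) := by
  rw [← hF.eq, ← mul_assoc, F.map_inv_mul, one_mul]

theorem IsCocycle.comulRight_eq (hF : F.IsCocycle) : mapAlg (comulRight 𝔤) F.series =
    mapAlg (leg23 𝔤) F.inv * (mapAlg (leg12 𝔤) F.series * mapAlg (comulLeft 𝔤) F.series) := by
  rw [hF.eq, ← mul_assoc, F.map_inv_mul, one_mul]

theorem IsCocycle.inv_eq (hF : F.IsCocycle) :
    mapAlg (comulLeft 𝔤) F.inv * mapAlg (leg12 𝔤) F.inv =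
      mapAlg (comulRight 𝔤) F.inv * mapAlg (leg23 𝔤) F.inv := by
  refine left_inv_eq_right_inv (a := mapAlg (leg12 𝔤) F.series * mapAlg (comulLeft 𝔤) F.series)
    ?_ ?_
  · rw [mul_assoc, ← mul_assoc (mapAlg (leg12 𝔤) F.inv), F.map_inv_mul, one_mul, F.map_inv_mul]
  · rw [hF.eq, mul_assoc, ← mul_assoc (mapAlg (comulRight 𝔤) F.series), F.map_mul_inv, one_mul,
      F.map_mul_inv]

theorem IsCocycle.swap (hF : F.IsCocycle) : F.swap.IsCocycle := by
  have h := congrArg (mapAlg (reverse 𝔤)) hF.eq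
  simp only [map_mul, mapAlg_mapAlg, reverse_comp_leg12, reverse_comp_leg23,
    reverse_comp_comulLeft, reverse_comp_comulRight] at h
  simp only [← mapAlg_mapAlg] at h
  exact h.symm

/-- `ℱ⁽¹⁾₍₁₎ ⊗ ℱ⁽¹⁾₍₂₎ S(ℱ⁽²⁾) = ℱ⁻¹ (1 ⊗ γ⁻¹)`. -/
theorem IsCocycle.contract23_comulLeft (hF : F.IsCocycle) :
    mapCoeff (contract23 𝔤) (mapAlg (comulLeft 𝔤) F.series) =
      F.inv * mapAlg (inr 𝔤) F.gammaInv := by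
  have h1 := fun s t => mapCoeff_mul (f := (leg12 𝔤).toLinearMap) (g := LinearMap.id)
    (f' := LinearMap.id) (fun a b => contract23_leg12_mul (𝔤 := 𝔤) a b) s t
  have h2 := fun s t => mapCoeff_mul_congr (f := LinearMap.id) (g := (comulRight 𝔤).toLinearMap)
    (f' := LinearMap.id) (g' := ((leg12 𝔤).comp ((inl 𝔤).comp (counitRight 𝔤))).toLinearMap)
    (fun a b => contract23_mul_comulRight (𝔤 := 𝔤) a b) s t
  simp only [mapCoeff_toLinearMap, mapCoeff_id] at h1 h2
  rw [hF.comulLeft_eq, h1, h2, ← mapAlg_mapAlg, ← mapAlg_mapAlg, F.counitRight_series, map_one,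
    map_one, mul_one, mapCoeff_mapAlg, gammaInv_eq, ← mapCoeff_toLinearMap (inr 𝔤),
    mapCoeff_mapCoeff]
  rfl

theorem IsCocycle.gammaInv_mul_gamma (hF : F.IsCocycle) : F.gammaInv * F.gamma = 1 := by
  have h1 := fun s t => mapCoeff_mul_swap (f := (leg23 𝔤).toLinearMap)
    (g := (leg12 𝔤).toLinearMap) (fun a b => contractAll_leg23_mul_leg12 (𝔤 := 𝔤) a b) s t
  have h2 := fun s t => mapCoeff_mul (f := (comulRight 𝔤).toLinearMap)
    (g := (comulLeft 𝔤).toLinearMap) (f' := (counitRight 𝔤).toLinearMap)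
    (g' := (counitLeft 𝔤).toLinearMap)
    (fun a b => contractAll_comulRight_mul_comulLeft (𝔤 := 𝔤) a b) s t
  simp only [mapCoeff_toLinearMap] at h1 h2
  have h3 : mapAlg (leg23 𝔤) F.inv * mapAlg (leg12 𝔤) F.series =
      mapAlg (comulRight 𝔤) F.series * mapAlg (comulLeft 𝔤) F.inv := by
    rw [hF.comulRight_eq, mul_assoc, mul_assoc, F.map_mul_inv, mul_one]
  rw [gammaInv_eq, gamma_eq, ← h1, h3, h2, F.counitRight_series, F.counitLeft_inv, one_mul]

theorem constantCoeff_inv : constantCoeff F.inv = 1 := by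
  rw [inv, constantCoeff_invOfUnit]; simp

theorem constantCoeff_gamma : constantCoeff F.gamma = 1 := by
  rw [gamma_eq, constantCoeff_mapCoeff, constantCoeff_inv, Algebra.TensorProduct.one_def,
    antiMul_tmul, anti_one, one_mul]

theorem IsCocycle.gamma_mul_gammaInv (hF : F.IsCocycle) : F.gamma * F.gammaInv = 1 := by
  have h : F.gamma * invOfUnit F.gamma 1 = 1 :=
    mul_invOfUnit _ _ (by simp [constantCoeff_gamma])
  rw [left_inv_eq_right_inv hF.gammaInv_mul_gamma h, h]

theorem IsCocycle.antiSeries_gamma_mul_gamma' (hF : F.IsCocycle) : antiSeries F.gamma * F.gamma' = 1 := by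
  rw [← antiSeries_gammaInv, ← antiSeries_mul, hF.gammaInv_mul_gamma, antiSeries_one]

theorem IsCocycle.gamma'_mul_antiSeries_gamma (hF : F.IsCocycle) : F.gamma' * antiSeries F.gamma = 1 := by
  rw [← antiSeries_gammaInv, ← antiSeries_mul, hF.gamma_mul_gammaInv, antiSeries_one]

/-- `ℱ Δ(γ⁻¹) = (γ⁻¹ ⊗ γ⁻¹) (S ⊗ S)(ℱ₂₁⁻¹)`. -/
theorem IsCocycle.series_mul_comul_gammaInv (hF : F.IsCocycle) :
    F.series * mapAlg Δ F.gammaInv =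
      mapAlg (inl 𝔤) F.gammaInv * mapAlg (inr 𝔤) F.gammaInv *
        mapCoeff (anti₂ 𝔤) (mapAlg (flip 𝔤) F.inv) := by
  have h1 := fun s t => mapCoeff_mul (f := ((comul3 𝔤).comp (leg12 𝔤)).toLinearMap)
    (g := LinearMap.id) (f' := LinearMap.id) (fun a b => nest_leg12_mul (𝔤 := 𝔤) a b) s t
  have h2 := fun s t => mapCoeff_mul_congr (f := LinearMap.id) (g := (comul2 𝔤).toLinearMap)
    (f' := LinearMap.id) (g' := ((leg14 𝔤).comp (counit2 𝔤)).toLinearMap)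
    (fun a b => nest_mul_comul2 (𝔤 := 𝔤) a b) s t
  have h3 := fun s t => mapCoeff_mul_swap (f := ((leg234 𝔤).comp (leg23 𝔤)).toLinearMap)
    (g := LinearMap.id) (f' := anti₂ 𝔤 ∘ₗ (flip 𝔤).toLinearMap)
    (fun a b => nest_leg34_mul (𝔤 := 𝔤) a b) s t
  have h4 := fun s t => mapCoeff_mul_swap (f := ((leg234 𝔤).comp (leg12 𝔤)).toLinearMap)
    (g := (leg14 𝔤).toLinearMap) (f' := (inr 𝔤).toLinearMap ∘ₗ mulAnti 𝔤)
    (g' := (inl 𝔤).toLinearMap ∘ₗ mulAnti 𝔤)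
    (fun a b => nest_leg23_mul_leg14 (𝔤 := 𝔤) a b) s t
  simp only [mapCoeff_toLinearMap, mapCoeff_id, ← mapCoeff_mapCoeff] at h1 h2 h3 h4
  have h5 : mapAlg Δ F.gammaInv =
      mapCoeff (nest 𝔤) (mapAlg ((comul3 𝔤).comp (comulLeft 𝔤)) F.series) := by
    rw [gammaInv_eq, ← mapCoeff_toLinearMap, mapCoeff_mapCoeff, mapCoeff_mapAlg]
    exact mapCoeff_congr comul_mulAnti _
  have h6 := congrArg (mapAlg (comul3 𝔤)) hF.eq
  have h7 := congrArg (mapAlg (leg234 𝔤)) hF.comulRight_eq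
  simp only [map_mul, mapAlg_mapAlg] at h6 h7
  have h8 : mapAlg ((leg234 𝔤).comp (comulLeft 𝔤)) F.series *
      mapAlg ((comul3 𝔤).comp (comulRight 𝔤)) F.series =
        mapAlg (comul2 𝔤) (mapAlg (leg23 𝔤) F.series * mapAlg (comulRight 𝔤) F.series) := by
    rw [map_mul, mapAlg_mapAlg, mapAlg_mapAlg, comul2_comp_comulRight, comul2_comp_leg23]
  rw [h5, ← h1, h6, comul3_comp_leg23, h7, mul_assoc, mul_assoc, h8, h3, h2,
    ← mapAlg_mapAlg (leg14 𝔤) (counit2 𝔤),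
    map_mul, mapAlg_mapAlg, mapAlg_mapAlg, counit2_comp_leg23, counit2_comp_comulRight,
    ← mapAlg_mapAlg (inr 𝔤), F.counitLeft_series, map_one, one_mul, mapAlg_id, h4]
  rfl

/-- `(1 ⊗ γ⁻¹) (id ⊗ S)(ℱ ℱ₂₁⁻¹) = ℱ₂₁ ℱ⁻¹ (1 ⊗ γ⁻¹)`. -/
theorem IsCocycle.universalR_mul_gammaInv (hF : F.IsCocycle) :
    mapAlg (inr 𝔤) F.gammaInv *
        mapCoeff (antipodeRight 𝔤) (F.series * mapAlg (flip 𝔤) F.inv) =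
      F.universalR * mapAlg (inr 𝔤) F.gammaInv := by
  have h1 := fun s t => mapCoeff_mul (f := (leg12 𝔤).toLinearMap) (g := LinearMap.id)
    (f' := LinearMap.id) (fun a b => contract23_leg12_mul (𝔤 := 𝔤) a b) s t
  have h2 := fun s t => mapCoeff_mul_congr (f := LinearMap.id) (g := (comulRight 𝔤).toLinearMap)
    (f' := LinearMap.id) (g' := ((leg12 𝔤).comp ((inl 𝔤).comp (counitRight 𝔤))).toLinearMap)
    (fun a b => contract23_mul_comulRight (𝔤 := 𝔤) a b) s t
  have h3 := fun s t => mapCoeff_mul_swap (f := ((flip12 𝔤).comp (leg23 𝔤)).toLinearMap)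
    (g := (leg23 𝔤).toLinearMap) (f' := antipodeRight 𝔤)
    (g' := (inr 𝔤).toLinearMap ∘ₗ mulAnti 𝔤)
    (fun a b => contract23_leg13_mul_leg23 (𝔤 := 𝔤) a b) s t
  simp only [mapCoeff_toLinearMap, mapCoeff_id, ← mapCoeff_mapCoeff] at h1 h2 h3
  have e1 : mapAlg (leg12 𝔤) (mapAlg (flip 𝔤) F.series) * mapAlg (comulLeft 𝔤) F.series =
      mapAlg ((flip12 𝔤).comp (leg23 𝔤)) F.series *
        mapAlg ((flip12 𝔤).comp (comulRight 𝔤)) F.series := by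
    have := congrArg (mapAlg (flip12 𝔤)) hF.eq
    have e : (flip12 𝔤).comp (leg12 𝔤) = (leg12 𝔤).comp (flip 𝔤) :=
      tensor₂_algHom_ext (by simp) (by simp)
    simp only [map_mul, mapAlg_mapAlg, flip12_comp_comulLeft, e] at this
    rw [mapAlg_mapAlg, this]
  have e2 : mapAlg ((flip12 𝔤).comp (comulRight 𝔤)) F.series =
      mapAlg ((flip12 𝔤).comp (leg23 𝔤)) (mapAlg (flip 𝔤) F.inv) *
        (mapAlg (leg23 𝔤) F.series * mapAlg (comulRight 𝔤) (mapAlg (flip 𝔤) F.series)) := by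
    have := congrArg (mapAlg (cycle 𝔤)) hF.comulRight_eq
    have e : (cycle 𝔤).comp (leg12 𝔤) = leg23 𝔤 := tensor₂_algHom_ext (by simp) (by simp)
    have e' : (cycle 𝔤).comp (leg23 𝔤) = ((flip12 𝔤).comp (leg23 𝔤)).comp (flip 𝔤) :=
      tensor₂_algHom_ext (by simp) (by simp)
    simp only [map_mul, mapAlg_mapAlg, cycle_comp_comulLeft, cycle_comp_comulRight, e, e'] at this
    rw [mapAlg_mapAlg, mapAlg_mapAlg, this]
  have e3 : mapAlg (counitRight 𝔤) (mapAlg (flip 𝔤) F.series) = 1 := F.swap.counitRight_series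
  have e4 : F.universalR = mapAlg (flip 𝔤) F.series * F.inv := rfl
  rw [e4, mul_assoc, ← hF.contract23_comulLeft, ← h1, e1, e2, ← mul_assoc, ← map_mul, ← mul_assoc,
    h2, ← mapAlg_mapAlg (leg12 𝔤), ← mapAlg_mapAlg (inl 𝔤), e3, map_one, map_one, mul_one, h3]
  rfl

/-! Consequences for the flipped twist. -/

theorem flip_inl_series (x : H⟦X⟧) :
    mapAlg (flip 𝔤) (mapAlg (inl 𝔤) x) = mapAlg (inr 𝔤) x := by
  ext n; simp

theorem flip_inr_series (x : H⟦X⟧) :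
    mapAlg (flip 𝔤) (mapAlg (inr 𝔤) x) = mapAlg (inl 𝔤) x := by
  ext n; simp

theorem inl_mul_inr_series (x y : H⟦X⟧) :
    mapAlg (inl 𝔤) x * mapAlg (inr 𝔤) y = mapAlg (inr 𝔤) y * mapAlg (inl 𝔤) x := by
  have := mapCoeff_mul_swap (L := LinearMap.id) (f := (inl 𝔤).toLinearMap)
    (g := (inr 𝔤).toLinearMap) (f' := (inl 𝔤).toLinearMap)
    (g' := (inr 𝔤).toLinearMap) (fun a b => by simp) x y
  simpa only [mapCoeff_toLinearMap, mapCoeff_id] using this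

theorem flip_anti₂ (t : H ⊗[ℂ] H) : flip 𝔤 (anti₂ 𝔤 t) = anti₂ 𝔤 (flip 𝔤 t) := by
  induction t with
  | zero => simp
  | add s t hs ht => simp only [map_add, hs, ht]
  | tmul x y => rfl

/-- `(S ⊗ S)(f(ℱ⁻¹))` is inverse to `(S ⊗ S)(f(ℱ))`. -/
theorem anti₂_mul_inv (f : H ⊗[ℂ] H →ₐ[ℂ] H ⊗[ℂ] H) :
    mapCoeff (anti₂ 𝔤) (mapAlg f F.inv) * mapCoeff (anti₂ 𝔤) (mapAlg f F.series) = 1 := by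
  rw [← anti₂_series_mul, F.map_mul_inv]
  exact mapCoeff_one (by rw [Algebra.TensorProduct.one_def, anti₂_tmul, anti_one])

theorem IsCocycle.swap_series_mul_comul_gamma' (hF : F.IsCocycle) :
    mapAlg (flip 𝔤) F.series * mapAlg Δ F.gamma' =
      mapAlg (inl 𝔤) F.gamma' * mapAlg (inr 𝔤) F.gamma' * mapCoeff (anti₂ 𝔤) F.inv := by
  have := hF.swap.series_mul_comul_gammaInv
  rwa [swap_inv, swap_series, flip_flip_series, ← gamma'_eq] at this

/-- `ℱ Δ(γ') = (γ' ⊗ γ') (S ⊗ S)(ℱ₂₁⁻¹)`. -/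
theorem IsCocycle.series_mul_comul_gamma' (hF : F.IsCocycle) :
    F.series * mapAlg Δ F.gamma' =
      mapAlg (inl 𝔤) F.gamma' * mapAlg (inr 𝔤) F.gamma' *
        mapCoeff (anti₂ 𝔤) (mapAlg (flip 𝔤) F.inv) := by
  have := congrArg (mapAlg (flip 𝔤)) hF.swap_series_mul_comul_gamma'
  have e1 : mapAlg (flip 𝔤) (mapAlg Δ F.gamma') = mapAlg Δ F.gamma' := by
    ext n; simp only [coeff_mapAlg, flip_comul]
  have e2 : mapAlg (flip 𝔤) (mapCoeff (anti₂ 𝔤) F.inv) =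
      mapCoeff (anti₂ 𝔤) (mapAlg (flip 𝔤) F.inv) := by
    ext n; simp only [coeff_mapAlg, coeff_mapCoeff, flip_anti₂]
  rwa [map_mul, map_mul, map_mul, flip_flip_series, e1, e2, flip_inl_series, flip_inr_series,
    ← inl_mul_inr_series] at this

theorem flip_universalR :
    mapAlg (flip 𝔤) F.universalR = F.series * mapAlg (flip 𝔤) F.inv := by
  change mapAlg (flip 𝔤) (mapAlg (flip 𝔤) F.series * F.inv) = _
  rw [map_mul, flip_flip_series]

/-- `ℛ₂₁ (γ' ⊗ γ') = (γ' ⊗ γ') (S ⊗ S)(ℛ₂₁)`. -/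
theorem IsCocycle.flip_universalR_mul_gamma'_tmul_gamma' (hF : F.IsCocycle) :
    mapAlg (flip 𝔤) F.universalR * (mapAlg (inl 𝔤) F.gamma' * mapAlg (inr 𝔤) F.gamma') =
      mapAlg (inl 𝔤) F.gamma' * mapAlg (inr 𝔤) F.gamma' *
        mapCoeff (anti₂ 𝔤) (mapAlg (flip 𝔤) F.universalR) := by
  have h : mapCoeff (anti₂ 𝔤) F.inv * mapCoeff (anti₂ 𝔤) F.series = 1 := by
    simpa only [mapAlg_id] using F.anti₂_mul_inv (AlgHom.id ℂ _)
  rw [flip_universalR, anti₂_series_mul, ← mul_assoc _ (mapCoeff _ _) (mapCoeff _ _),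
    ← hF.series_mul_comul_gamma', mul_assoc, mul_assoc]
  congr 1
  calc _ = mapAlg (flip 𝔤) F.inv * (mapAlg (inl 𝔤) F.gamma' * mapAlg (inr 𝔤) F.gamma' *
        (mapCoeff (anti₂ 𝔤) F.inv * mapCoeff (anti₂ 𝔤) F.series)) := by rw [h, mul_one]
    _ = _ := by
      rw [← mul_assoc _ (mapCoeff _ _) (mapCoeff _ _), ← hF.swap_series_mul_comul_gamma',
        ← mul_assoc, ← mul_assoc, F.map_inv_mul, one_mul]

/-- `ℛ₂₁ (1 ⊗ γ') = (1 ⊗ γ') (id ⊗ S)(ℛ)`. -/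
theorem IsCocycle.flip_universalR_mul_gamma' (hF : F.IsCocycle) :
    mapAlg (flip 𝔤) F.universalR * mapAlg (inr 𝔤) F.gamma' =
      mapAlg (inr 𝔤) F.gamma' * mapCoeff (antipodeRight 𝔤) F.universalR := by
  have h := hF.swap.universalR_mul_gammaInv
  have e : F.swap.universalR = F.series * mapAlg (flip 𝔤) F.inv := by
    change mapAlg (flip 𝔤) F.swap.series * F.swap.inv = _
    rw [swap_series, flip_flip_series, swap_inv]
  rw [← gamma'_eq, swap_series, swap_inv, flip_flip_series, e] at h
  rw [flip_universalR, ← h]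
  rfl

end Twist

/-! ## The action of `U𝔤` on the Weyl or Clifford algebra -/

section Action

variable {𝔤 : Type*} [LieRing 𝔤] [LieAlgebra ℂ 𝔤] {I : Type*} [Fintype I] [DecidableEq I]
  (κ : Kind) (ρ : Ug 𝔤 →ₐ[ℂ] Matrix I I ℂ)

local notation "H" => Ug 𝔤
local notation "Δ" => Bialgebra.comulAlgHom ℂ (Ug 𝔤)
local notation "𝓐" => OscAlg κ I
local notation "σ" => sigma κ ρ

/-- `x ⊗ y ↦ (b ↦ σ(x) b σ(y))`. -/
def sandwichSigma : H ⊗[ℂ] H →ₗ[ℂ] 𝓐 →ₗ[ℂ] 𝓐 :=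
  sandwichLin 𝓐 ∘ₗ (Algebra.TensorProduct.map σ σ).toLinearMap

@[simp] theorem sandwichSigma_tmul (x y : H) (b : 𝓐) :
    sandwichSigma κ ρ (x ⊗ₜ y) b = σ x * b * σ y :=
  sandwichLin_tmul _ _ _

/-- `x ⊗ y ↦ (b ↦ σ(x) b σ(S y))`. -/
def conj : H ⊗[ℂ] H →ₗ[ℂ] 𝓐 →ₗ[ℂ] 𝓐 := sandwichSigma κ ρ ∘ₗ antipodeRight 𝔤

@[simp] theorem conj_tmul (x y : H) (b : 𝓐) :
    conj κ ρ (x ⊗ₜ y) b = σ x * b * σ (anti 𝔤 y) :=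
  sandwichSigma_tmul _ _ _ _ _

theorem conj_mul (s t : H ⊗[ℂ] H) (b : 𝓐) :
    conj κ ρ (s * t) b = conj κ ρ s (conj κ ρ t b) := by
  induction s with
  | zero => simp
  | add s s' h h' => simp only [add_mul, map_add, LinearMap.add_apply, h, h']
  | tmul x y =>
    induction t with
    | zero => simp
    | add s s' h h' => simp only [mul_add, map_add, LinearMap.add_apply, h, h']
    | tmul z w => simp [anti_mul, mul_assoc]

/-- The adjoint action `x ▷ b = σ(x₍₁₎) b σ(S x₍₂₎)`. -/
def adj : H →ₗ[ℂ] 𝓐 →ₗ[ℂ] 𝓐 := conj κ ρ ∘ₗ (Δ).toLinearMap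

theorem adj_apply (x : H) (b : 𝓐) : adj κ ρ x b = conj κ ρ (Δ x) b := rfl

theorem adj_mul (x y : H) (b : 𝓐) : adj κ ρ (x * y) b = adj κ ρ x (adj κ ρ y b) := by
  rw [adj_apply, map_mul, conj_mul]
  rfl

theorem adj_one (b : 𝓐) : adj κ ρ 1 b = b := by
  rw [adj_apply, map_one, Algebra.TensorProduct.one_def, conj_tmul, anti_one, map_one, one_mul,
    mul_one]

theorem adj_algebraMap (r : ℂ) (b : 𝓐) : adj κ ρ (algebraMap ℂ H r) b = r • b := by
  rw [Algebra.algebraMap_eq_smul_one, map_smul, LinearMap.smul_apply, adj_one]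

theorem adj_ι (X : 𝔤) (b : 𝓐) : adj κ ρ (UniversalEnvelopingAlgebra.ι ℂ X) b =
    σ (UniversalEnvelopingAlgebra.ι ℂ X) * b - b * σ (UniversalEnvelopingAlgebra.ι ℂ X) := by
  rw [adj_apply, comul_ι, map_add, LinearMap.add_apply, conj_tmul, conj_tmul, anti_one, anti_ι,
    map_one, map_neg, mul_one, one_mul, mul_neg, sub_eq_add_neg]

/-- `x ⊗ y ↦ (x ▷ b) σ(y)`. -/
def dress (b : 𝓐) : H ⊗[ℂ] H →ₗ[ℂ] 𝓐 :=
  LinearMap.mul' ℂ 𝓐 ∘ₗ TensorProduct.map ((adj κ ρ).flip b) (σ).toLinearMap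

@[simp] theorem dress_tmul (x y : H) (b : 𝓐) :
    dress κ ρ b (x ⊗ₜ y) = adj κ ρ x b * σ y := rfl

theorem sigma_mul_dress (y : H) (c : 𝓐) (t : H ⊗[ℂ] H) :
    σ y * dress κ ρ c t = dress κ ρ c (Δ y * t) := by
  induction y using Ug.induction generalizing t with
  | hscalar r => simp [Algebra.algebraMap_eq_smul_one]
  | hadd x y hx hy => simp only [map_add, add_mul, hx, hy]
  | hmul x y hx hy => rw [map_mul (σ), map_mul (Δ), mul_assoc, mul_assoc, hy, hx]
  | hι X =>
    induction t with
    | zero => simp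
    | add s t hs ht => simp only [mul_add, map_add, hs, ht]
    | tmul p q =>
      rw [comul_ι, add_mul, Algebra.TensorProduct.tmul_mul_tmul,
        Algebra.TensorProduct.tmul_mul_tmul, map_add, dress_tmul, dress_tmul, dress_tmul,
        adj_mul, adj_ι, one_mul, one_mul, map_mul]
      noncomm_ring

theorem dress_mul_inr (t : H ⊗[ℂ] H) (y : H) (b : 𝓐) :
    dress κ ρ b (t * inr 𝔤 y) = dress κ ρ b t * σ y := by
  induction t with
  | zero => simp
  | add s t hs ht => simp only [add_mul, map_add, hs, ht]
  | tmul p q => simp [mul_assoc]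

theorem sigma_mul (x : H) (b : 𝓐) : σ x * b = dress κ ρ b (Δ x) := by
  have := sigma_mul_dress κ ρ x b 1
  rwa [mul_one, Algebra.TensorProduct.one_def, dress_tmul, adj_one, map_one, mul_one] at this

/-- `σ(x) b σ(S y) = (x₍₁₎ ▷ b) σ(x₍₂₎ S(y))`. -/
theorem conj_eq_dress (s : H ⊗[ℂ] H) (b : 𝓐) :
    conj κ ρ s b = dress κ ρ b (contract23 𝔤 (comulLeft 𝔤 s)) := by
  induction s with
  | zero => simp
  | add s t hs ht => simp only [map_add, LinearMap.add_apply, hs, ht]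
  | tmul x y =>
    have key : ∀ p : H ⊗[ℂ] H,
        contract23 𝔤 (Algebra.TensorProduct.assoc ℂ ℂ ℂ H H H (p ⊗ₜ y)) =
          p * inr 𝔤 (anti 𝔤 y) := by
      intro p
      induction p with
      | zero => simp
      | add s t hs ht => simp only [TensorProduct.add_tmul, map_add, add_mul, hs, ht]
      | tmul a b => simp
    rw [conj_tmul, comulLeft_tmul, key, dress_mul_inr, ← sigma_mul]

/-- `x ⊗ y ⊗ z ↦ (x ▷ b) (y ▷ c) σ(z)`. -/
def dress₂ (b c : 𝓐) : H ⊗[ℂ] (H ⊗[ℂ] H) →ₗ[ℂ] 𝓐 :=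
  LinearMap.mul' ℂ 𝓐 ∘ₗ TensorProduct.map ((adj κ ρ).flip b) (dress κ ρ c)

@[simp] theorem dress₂_tmul (x : H) (t : H ⊗[ℂ] H) (b c : 𝓐) :
    dress₂ κ ρ b c (x ⊗ₜ t) = adj κ ρ x b * dress κ ρ c t := rfl

theorem dress_mul_dress (b c : 𝓐) (s t : H ⊗[ℂ] H) :
    dress κ ρ b s * dress κ ρ c t = dress₂ κ ρ b c (comulRight 𝔤 s * leg23 𝔤 t) := by
  induction s with
  | zero => simp
  | add s t hs ht => simp only [add_mul, map_add, hs, ht]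
  | tmul x y =>
    rw [dress_tmul, comulRight_tmul, leg23_apply, Algebra.TensorProduct.tmul_mul_tmul, mul_one,
      dress₂_tmul, ← sigma_mul_dress, mul_assoc]

/-- The vectors `b i` span a representation of `U𝔤` with matrix elements `n l i`. -/
def IsCovariant (b : I → 𝓐) (n : I → I → H →ₗ[ℂ] ℂ) : Prop :=
  ∀ x i, adj κ ρ x (b i) = ∑ l, n l i x • b l

/-- Commutator of `M^i_j a⁺_i a^j` with `a⁺_k`. -/
theorem quadratic_mul_aPlus (M : Matrix I I ℂ) (k : I) :
    quadratic κ M * aPlus κ k - aPlus κ k * quadratic κ M = ∑ l, M l k • aPlus κ l := by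
  have h : ∀ i j, aPlus κ i * a κ j * aPlus κ k - aPlus κ k * (aPlus κ i * a κ j) =
      if j = k then aPlus κ i else 0 := by
    intro i j
    rw [mul_assoc, OscAlg.ann_mul_cre, ← mul_assoc (aPlus κ k), OscAlg.cre_mul_cre k i]
    cases κ <;> simp [Kind.sign, mul_add, mul_assoc]
  simp only [quadratic, LinearMap.coe_mk, AddHom.coe_mk, Finset.sum_mul, Finset.mul_sum,
    ← Finset.sum_sub_distrib, smul_mul_assoc, mul_smul_comm, ← smul_sub, h]
  simp

/-- Commutator of `M^i_j a⁺_i a^j` with `a^k`. -/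
theorem quadratic_mul_a (M : Matrix I I ℂ) (k : I) :
    quadratic κ M * a κ k - a κ k * quadratic κ M = -∑ l, M k l • a κ l := by
  have h : ∀ i j, aPlus κ i * a κ j * a κ k - a κ k * (aPlus κ i * a κ j) =
      -if k = i then a κ j else 0 := by
    intro i j
    rw [mul_assoc, OscAlg.ann_mul_ann j k, ← mul_assoc (a κ k), OscAlg.ann_mul_cre]
    cases κ <;> simp [Kind.sign, add_mul, mul_assoc]
  simp only [quadratic, LinearMap.coe_mk, AddHom.coe_mk, Finset.sum_mul, Finset.mul_sum,
    ← Finset.sum_sub_distrib, smul_mul_assoc, mul_smul_comm, ← smul_sub, h]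
  rw [Finset.sum_comm]
  simp

theorem sigma_ι_eq_quadratic (X : 𝔤) : σ (UniversalEnvelopingAlgebra.ι ℂ X) =
    quadratic κ (ρ (UniversalEnvelopingAlgebra.ι ℂ X)) :=
  sigma_ι κ ρ X

theorem repEntry_apply (i j : I) (x : H) : repEntry ρ i j x = ρ x i j := rfl

theorem isCovariant_aPlus : IsCovariant κ ρ (aPlus κ) (repEntry ρ) := by
  intro x
  induction x using Ug.induction with
  | hι X =>
    intro i
    rw [adj_ι, sigma_ι_eq_quadratic, quadratic_mul_aPlus]
    rfl
  | hscalar r =>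
    intro i
    rw [adj_algebraMap]
    simp [repEntry_apply, Algebra.algebraMap_eq_smul_one, Matrix.one_apply]
  | hadd x y hx hy =>
    intro i
    simp only [map_add, LinearMap.add_apply, hx, hy, add_smul, Finset.sum_add_distrib]
  | hmul x y hx hy =>
    intro i
    simp only [adj_mul, hy, map_sum, map_smul, hx, Finset.smul_sum, smul_smul]
    rw [Finset.sum_comm]
    refine Finset.sum_congr rfl fun l _ => ?_
    rw [← Finset.sum_smul]
    simp only [repEntry_apply, map_mul, Matrix.mul_apply, mul_comm]

theorem isCovariant_a :
    IsCovariant κ ρ (a κ) fun l i => repEntry ρ i l ∘ₗ anti 𝔤 := by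
  intro x
  induction x using Ug.induction with
  | hι X =>
    intro i
    rw [adj_ι, sigma_ι_eq_quadratic, quadratic_mul_a]
    simp only [LinearMap.comp_apply, anti_ι, map_neg, neg_smul, Finset.sum_neg_distrib]
    rfl
  | hscalar r =>
    intro i
    simp only [LinearMap.comp_apply, anti_algebraMap, adj_algebraMap]
    simp [repEntry_apply, Algebra.algebraMap_eq_smul_one, Matrix.one_apply]
  | hadd x y hx hy =>
    intro i
    simp only [map_add, LinearMap.add_apply, hx, hy, add_smul, Finset.sum_add_distrib]
  | hmul x y hx hy =>
    intro i
    simp only [adj_mul, hy, map_sum, map_smul, hx, Finset.smul_sum, smul_smul]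
    rw [Finset.sum_comm]
    refine Finset.sum_congr rfl fun l _ => ?_
    rw [← Finset.sum_smul]
    simp only [LinearMap.comp_apply, anti_mul, repEntry_apply, map_mul, Matrix.mul_apply, mul_comm]

variable {κ ρ}

theorem IsCovariant.conj_mul_comul {b : I → 𝓐} {n : I → I → H →ₗ[ℂ] ℂ}
    (hb : IsCovariant κ ρ b n) (i : I) (t : H ⊗[ℂ] H) (x : H) :
    conj κ ρ (t * Δ x) (b i) = ∑ l, n l i x • conj κ ρ t (b l) := by
  rw [conj_mul, ← adj_apply, hb]
  simp only [map_sum, map_smul]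

/-- `φ ⊗ ψ` as a functional on `U𝔤 ⊗ U𝔤`. -/
abbrev pairing (φ ψ : H →ₗ[ℂ] ℂ) : H ⊗[ℂ] H →ₗ[ℂ] ℂ :=
  LinearMap.mul' ℂ ℂ ∘ₗ TensorProduct.map φ ψ

theorem IsCovariant.dress₂_mul_leg12 {b c : I → 𝓐} {n m : I → I → H →ₗ[ℂ] ℂ}
    (hb : IsCovariant κ ρ b n) (hc : IsCovariant κ ρ c m) (i j : I)
    (t : H ⊗[ℂ] (H ⊗[ℂ] H)) (s : H ⊗[ℂ] H) :
    dress₂ κ ρ (b i) (c j) (t * leg12 𝔤 s) =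
      ∑ p : I × I, pairing (n p.1 i) (m p.2 j) s • dress₂ κ ρ (b p.1) (c p.2) t := by
  induction s with
  | zero => simp
  | add s t hs ht => simp only [mul_add, map_add, hs, ht, add_smul, Finset.sum_add_distrib]
  | tmul x y =>
    induction t using tensor₃_induction with
    | zero => simp
    | add s t hs ht => simp only [add_mul, map_add, hs, ht, smul_add, Finset.sum_add_distrib]
    | tmul z w v =>
      rw [leg12_tmul, Algebra.TensorProduct.tmul_mul_tmul, Algebra.TensorProduct.tmul_mul_tmul,
        mul_one, dress₂_tmul, dress_tmul, adj_mul, adj_mul, hb, hc, Fintype.sum_prod_type]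
      simp only [map_sum, map_smul, Finset.sum_mul, Finset.mul_sum, dress₂_tmul, dress_tmul,
        smul_mul_assoc, mul_smul_comm, LinearMap.comp_apply, TensorProduct.map_tmul,
        LinearMap.mul'_apply, Finset.smul_sum, smul_smul]
      rw [Finset.sum_comm]
      simp only [mul_comm]

theorem IsCovariant.adj_mul_adj {b c : I → 𝓐} {n m : I → I → H →ₗ[ℂ] ℂ}
    (hb : IsCovariant κ ρ b n) (hc : IsCovariant κ ρ c m) (i j : I) (x y : H) :
    adj κ ρ x (b i) * adj κ ρ y (c j) =
      ∑ p : I × I, (n p.1 i x * m p.2 j y) • (b p.1 * c p.2) := by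
  rw [hb, hc, Finset.sum_mul_sum, Fintype.sum_prod_type]
  simp only [smul_mul_smul_comm]

theorem IsCovariant.adj_mul_adj_swap {b c : I → 𝓐} {n m : I → I → H →ₗ[ℂ] ℂ}
    (hb : IsCovariant κ ρ b n) (hc : IsCovariant κ ρ c m) (i j : I) (x y : H) :
    adj κ ρ y (c j) * adj κ ρ x (b i) =
      ∑ p : I × I, (n p.1 i x * m p.2 j y) • (c p.2 * b p.1) := by
  rw [hb, hc, Finset.sum_mul_sum, Finset.sum_comm, Fintype.sum_prod_type]
  simp only [smul_mul_smul_comm, mul_comm]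

theorem IsCovariant.dress₂_comm {b c : I → 𝓐} {n m : I → I → H →ₗ[ℂ] ℂ}
    (hb : IsCovariant κ ρ b n) (hc : IsCovariant κ ρ c m)
    (h : ∀ i j, b i * c j = κ.sign • (c j * b i)) (i j : I) (t : H ⊗[ℂ] (H ⊗[ℂ] H)) :
    dress₂ κ ρ (b i) (c j) t = κ.sign • dress₂ κ ρ (c j) (b i) (flip12 𝔤 t) := by
  induction t using tensor₃_induction with
  | zero => simp
  | add s t hs ht => simp only [map_add, hs, ht, smul_add]
  | tmul x y z =>
    rw [flip12_tmul, dress₂_tmul, dress₂_tmul, dress_tmul, dress_tmul, ← mul_assoc, ← mul_assoc,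
      ← smul_mul_assoc, hb.adj_mul_adj hc, hb.adj_mul_adj_swap hc]
    simp only [h, Finset.smul_sum, smul_comm (κ.sign)]

variable (κ ρ)

/-- `x ⊗ y ⊗ z ↦ ρ(S(x) y)^i_j σ(z)`. -/
def contractedPart (i j : I) : H ⊗[ℂ] (H ⊗[ℂ] H) →ₗ[ℂ] 𝓐 :=
  (TensorProduct.lid ℂ 𝓐).toLinearMap ∘ₗ
    TensorProduct.map (repEntry ρ i j ∘ₗ antiMul 𝔤) (σ).toLinearMap ∘ₗ
      (TensorProduct.assoc ℂ H H H).symm.toLinearMap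

@[simp] theorem contractedPart_tmul (i j : I) (x y z : H) :
    contractedPart κ ρ i j (x ⊗ₜ (y ⊗ₜ z)) = repEntry ρ i j (anti 𝔤 x * y) • σ z := rfl

theorem dress₂_a_aPlus (i j : I) (t : H ⊗[ℂ] (H ⊗[ℂ] H)) :
    dress₂ κ ρ (a κ i) (aPlus κ j) t =
      contractedPart κ ρ i j t +
        κ.sign • dress₂ κ ρ (aPlus κ j) (a κ i) (flip12 𝔤 t) := by
  induction t using tensor₃_induction with
  | zero => simp
  | add s t hs ht => simp only [map_add, hs, ht, smul_add]; abel
  | tmul x y z =>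
    have e : ∑ p : I × I, ((repEntry ρ i p.1 ∘ₗ anti 𝔤) x * repEntry ρ p.2 j y) •
        (if p.1 = p.2 then (1 : 𝓐) else 0) = repEntry ρ i j (anti 𝔤 x * y) • 1 := by
      rw [Fintype.sum_prod_type, repEntry_apply, map_mul, Matrix.mul_apply, Finset.sum_smul]
      simp [repEntry_apply]
    rw [flip12_tmul, dress₂_tmul, dress₂_tmul, dress_tmul, dress_tmul, ← mul_assoc, ← mul_assoc,
      ← smul_mul_assoc, (isCovariant_a κ ρ).adj_mul_adj (isCovariant_aPlus κ ρ),
      (isCovariant_a κ ρ).adj_mul_adj_swap (isCovariant_aPlus κ ρ), contractedPart_tmul,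
      ← one_mul (σ z), ← smul_mul_assoc, one_mul, ← add_mul, ← e]
    simp only [OscAlg.ann_mul_cre, Finset.smul_sum, smul_add, Finset.sum_add_distrib,
      smul_comm (κ.sign)]

theorem contractedPart_comulLeft_mul_leg12 (i j : I) (s t : H ⊗[ℂ] H) :
    contractedPart κ ρ i j (comulLeft 𝔤 s * leg12 𝔤 t) =
      repEntry ρ i j (antiMul 𝔤 t) • σ (counitLeft 𝔤 s) := by
  induction t with
  | zero => simp
  | add s t hs ht => simp only [mul_add, map_add, hs, ht, add_smul]
  | tmul x y =>
    induction s with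
    | zero => simp
    | add s t hs ht => simp only [add_mul, map_add, hs, ht, smul_add]
    | tmul z w =>
      have key : ∀ p : H ⊗[ℂ] H, contractedPart κ ρ i j
          (Algebra.TensorProduct.assoc ℂ ℂ ℂ H H H (p ⊗ₜ w) * leg12 𝔤 (x ⊗ₜ y)) =
            repEntry ρ i j (anti 𝔤 x * antiMul 𝔤 p * y) • σ w := by
        intro p
        induction p with
        | zero => simp
        | add s t hs ht => simp only [TensorProduct.add_tmul, map_add, add_mul, mul_add, hs, ht,
            add_smul]
        | tmul a b => simp [anti_mul, mul_assoc]
      rw [comulLeft_tmul, key, antiMul_comul]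
      simp [Algebra.algebraMap_eq_smul_one, smul_smul, mul_comm]

end Action

/-! ## Twisted generators -/

theorem coeff_smul_series {κ : Kind} {I : Type*} [DecidableEq I] (c : ℂ⟦X⟧)
    (x : (OscAlg κ I)⟦X⟧) (n : ℕ) :
    coeff n (c • x) =
      ∑ p ∈ Finset.HasAntidiagonal.antidiagonal n, coeff p.1 c • coeff p.2 x := by
  rw [Algebra.smul_def, coeff_mul]
  refine Finset.sum_congr rfl fun p _ => ?_
  rw [Algebra.smul_def]
  congr 1

theorem mapCoeff_mul_eq_sum_smul {κ : Kind} {I J M N P : Type*} [DecidableEq I] [Fintype J]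
    [Semiring M] [Algebra ℂ M] [Semiring N] [Algebra ℂ N] [Semiring P] [Algebra ℂ P]
    {L : P →ₗ[ℂ] OscAlg κ I} {f : M →ₗ[ℂ] P} {g : N →ₗ[ℂ] P} {φ : J → N →ₗ[ℂ] ℂ}
    {ψ : J → M →ₗ[ℂ] OscAlg κ I}
    (h : ∀ a b, L (f a * g b) = ∑ j, φ j b • ψ j a) (x : M⟦X⟧) (y : N⟦X⟧) :
    mapCoeff L (mapCoeff f x * mapCoeff g y) =
      ∑ j, mapCoeff (φ j) y • mapCoeff (ψ j) x := by
  ext n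
  rw [coeff_mapCoeff, coeff_mul, map_sum, map_sum]
  simp only [coeff_mapCoeff, coeff_smul_series, h]
  rw [Finset.sum_comm]
  refine Finset.sum_congr rfl fun j _ => ?_
  rw [← Finset.Nat.sum_antidiagonal_swap]
  rfl

namespace Twist

variable {𝔤 : Type*} [LieRing 𝔤] [LieAlgebra ℂ 𝔤] {I : Type*} [Fintype I] [DecidableEq I]
  (κ : Kind) (ρ : Ug 𝔤 →ₐ[ℂ] Matrix I I ℂ) (F : Twist 𝔤)

local notation "H" => Ug 𝔤
local notation "Δ" => Bialgebra.comulAlgHom ℂ (Ug 𝔤)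
local notation "𝓐" => OscAlg κ I
local notation "σ" => sigma κ ρ

/-- The dressing `ℱ⁽¹⁾ (y ▷ b) S(ℱ⁽²⁾) γ` of `y ▷ b`. -/
def dressed (b : 𝓐) (y : H⟦X⟧) : 𝓐⟦X⟧ :=
  mapCoeff ((conj κ ρ).flip b)
    (mapAlg (inr 𝔤) (antiSeries F.gamma) * (F.series * mapAlg Δ y))

theorem sandwich_C (b : 𝓐) (t : (H ⊗[ℂ] H)⟦X⟧) :
    sandwich (sigma₂ κ ρ t) (C b) = mapCoeff ((sandwichSigma κ ρ).flip b) t := by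
  ext n
  rw [sandwich, coeff_mk, coeff_mapCoeff, Finset.sum_eq_single (n, 0)]
  · rw [coeff_zero_C, sigma₂, coeff_map]
    rfl
  · rintro ⟨i, j⟩ hij hne
    have : j ≠ 0 := by
      rintro rfl
      simp only [Finset.HasAntidiagonal.mem_antidiagonal, add_zero] at hij
      exact hne (by rw [hij])
    rw [coeff_C, if_neg this, map_zero]
  · exact fun h => absurd (Finset.HasAntidiagonal.mem_antidiagonal.2 (add_zero n)) h

theorem sandwich_mapCoeff_conj (b : 𝓐) (s t : (H ⊗[ℂ] H)⟦X⟧) :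
    sandwich (sigma₂ κ ρ (mapCoeff (antipodeRight 𝔤) s)) (mapCoeff ((conj κ ρ).flip b) t) =
      mapCoeff ((conj κ ρ).flip b) (s * t) := by
  ext n
  rw [sandwich, coeff_mk, coeff_mapCoeff, coeff_mul, map_sum]
  refine Finset.sum_congr rfl fun p _ => ?_
  rw [LinearMap.flip_apply, conj_mul, sigma₂, coeff_map, coeff_mapCoeff, coeff_mapCoeff]
  rfl

theorem antipodeRight_inr_mul (a : H⟦X⟧) (t : (H ⊗[ℂ] H)⟦X⟧) :
    mapCoeff (antipodeRight 𝔤) (mapAlg (inr 𝔤) a * t) =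
      mapCoeff (antipodeRight 𝔤) t * mapAlg (inr 𝔤) (antiSeries a) := by
  have h := mapCoeff_mul_swap (L := antipodeRight 𝔤) (f := (inr 𝔤).toLinearMap)
    (g := LinearMap.id) (f' := (inr 𝔤).toLinearMap ∘ₗ anti 𝔤) (g' := antipodeRight 𝔤)
    (fun a t => by
      induction t with
      | zero => simp
      | add s t hs ht => rw [map_add, mul_add, map_add, hs, ht, map_add, add_mul]
      | tmul x y => simp [antipodeRight, anti_mul]) a t
  simpa only [mapCoeff_toLinearMap, mapCoeff_id, ← mapCoeff_mapCoeff] using h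

theorem antipodeRight_mul_inr (a : H⟦X⟧) (t : (H ⊗[ℂ] H)⟦X⟧) :
    mapCoeff (antipodeRight 𝔤) (t * mapAlg (inr 𝔤) a) =
      mapAlg (inr 𝔤) (antiSeries a) * mapCoeff (antipodeRight 𝔤) t := by
  have h := mapCoeff_mul_swap (L := antipodeRight 𝔤) (g := (inr 𝔤).toLinearMap)
    (f := LinearMap.id) (g' := (inr 𝔤).toLinearMap ∘ₗ anti 𝔤) (f' := antipodeRight 𝔤)
    (fun t a => by
      induction t with
      | zero => simp
      | add s t hs ht => rw [map_add, add_mul, map_add, hs, ht, map_add, mul_add]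
      | tmul x y => simp [antipodeRight, anti_mul]) t a
  simpa only [mapCoeff_toLinearMap, mapCoeff_id, ← mapCoeff_mapCoeff] using h

theorem mapCoeff_conj (b : 𝓐) (t : (H ⊗[ℂ] H)⟦X⟧) :
    mapCoeff ((conj κ ρ).flip b) t =
      mapCoeff ((sandwichSigma κ ρ).flip b) (mapCoeff (antipodeRight 𝔤) t) := by
  rw [mapCoeff_mapCoeff]
  rfl

theorem Aplus_eq_dressed (i : I) : F.Aplus κ ρ i = F.dressed κ ρ (aPlus κ i) 1 := by
  rw [Aplus, sandwich_C, dressed, map_one, mul_one, mapCoeff_conj, antipodeRight_inr_mul,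
    antiSeries_antiSeries]
  rfl

theorem antipodeRight_anti₂ (a : H⟦X⟧) (t : (H ⊗[ℂ] H)⟦X⟧) :
    mapCoeff (antipodeRight 𝔤) (mapAlg (inl 𝔤) a * mapCoeff (anti₂ 𝔤) t) =
      mapAlg (inl 𝔤) a * mapCoeff (antipodeLeft 𝔤) t := by
  have h := mapCoeff_mul (L := antipodeRight 𝔤) (f := (inl 𝔤).toLinearMap)
    (g := anti₂ 𝔤) (f' := (inl 𝔤).toLinearMap) (g' := antipodeLeft 𝔤)
    (fun a t => by
      induction t with
      | zero => simp
      | add s t hs ht => rw [map_add, mul_add, map_add, hs, ht, map_add, mul_add]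
      | tmul x y => simp [antipodeRight, antipodeLeft, anti_anti]) a t
  simpa only [mapCoeff_toLinearMap] using h

variable {F}

theorem IsCocycle.A_eq_dressed (hF : F.IsCocycle) (i : I) :
    F.A κ ρ i = F.dressed κ ρ (a κ i) F.gamma' := by
  rw [A, sandwich_C, dressed, hF.series_mul_comul_gamma', mapCoeff_conj, inl_mul_inr_series,
    ← mul_assoc, ← mul_assoc, ← map_mul, hF.antiSeries_gamma_mul_gamma', map_one, one_mul,
    antipodeRight_anti₂, ← mapCoeff_toLinearMap (flip 𝔤), mapCoeff_mapCoeff]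
  rfl

theorem IsCocycle.act_dressed (hF : F.IsCocycle) (x y : H⟦X⟧) (b : 𝓐) :
    F.act κ ρ x (F.dressed κ ρ b y) = F.dressed κ ρ b (x * y) := by
  have h : F.idTensorAntipode (F.comul x) = mapCoeff (antipodeRight 𝔤)
      (mapAlg (inr 𝔤) (antiSeries F.gamma) * (F.comul x *
        mapAlg (inr 𝔤) (antiSeries F.gammaInv))) := by
    rw [antipodeRight_inr_mul, antipodeRight_mul_inr, antiSeries_antiSeries,
      antiSeries_antiSeries]
    rfl
  have h' : F.comul x = F.series * mapAlg Δ x * F.inv := rfl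
  have h'' : mapAlg (inr 𝔤) (antiSeries F.gammaInv) * mapAlg (inr 𝔤) (antiSeries F.gamma) = 1 := by
    rw [← map_mul, ← antiSeries_mul, hF.gamma_mul_gammaInv, antiSeries_one, map_one]
  rw [act, h, dressed, sandwich_mapCoeff_conj, dressed, h', map_mul]
  congr 1
  simp only [mul_assoc]
  rw [← mul_assoc (mapAlg (inr 𝔤) (antiSeries F.gammaInv)), h'', one_mul, ← mul_assoc F.inv,
    F.inv_mul, one_mul]

theorem dressed_mul_eq_sum {b : I → 𝓐} {n : I → I → H →ₗ[ℂ] ℂ} (hb : IsCovariant κ ρ b n)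
    (i : I) (x y : H⟦X⟧) :
    F.dressed κ ρ (b i) (x * y) = ∑ l, mapCoeff (n l i) y • F.dressed κ ρ (b l) x := by
  have h := fun s t => mapCoeff_mul_eq_sum_smul (L := (conj κ ρ).flip (b i)) (f := LinearMap.id)
    (g := (Δ).toLinearMap) (φ := fun l => n l i) (ψ := fun l => (conj κ ρ).flip (b l))
    (fun s t => hb.conj_mul_comul i s t) s t
  simp only [mapCoeff_id, mapCoeff_toLinearMap] at h
  simp only [dressed]
  rw [map_mul, ← mul_assoc, ← mul_assoc, h]
  simp only [mul_assoc]

theorem IsCocycle.act_Aplus (hF : F.IsCocycle) (x : H⟦X⟧) (i : I) :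
    F.act κ ρ x (F.Aplus κ ρ i) = ∑ l, repCoeff ρ x l i • F.Aplus κ ρ l := by
  simp only [Aplus_eq_dressed]
  rw [hF.act_dressed, mul_one, ← one_mul x, dressed_mul_eq_sum κ ρ (isCovariant_aPlus κ ρ)]
  simp only [one_mul]
  rfl

theorem IsCocycle.act_A (hF : F.IsCocycle) (x : H⟦X⟧) (i : I) :
    F.act κ ρ x (F.A κ ρ i) = ∑ l, repCoeff ρ (F.antipode x) i l • F.A κ ρ l := by
  have h : x * F.gamma' = F.gamma' * (antiSeries F.gamma * x * F.gamma') := by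
    rw [← mul_assoc, ← mul_assoc, hF.gamma'_mul_antiSeries_gamma, one_mul]
  have h' : antiSeries (antiSeries F.gamma * x * F.gamma') = F.antipode x := by
    rw [antiSeries_mul, antiSeries_mul, antiSeries_antiSeries, antiSeries_gamma', ← mul_assoc]
    rfl
  simp only [hF.A_eq_dressed]
  rw [hF.act_dressed, h, dressed_mul_eq_sum κ ρ (isCovariant_a κ ρ)]
  simp only [← mapCoeff_mapCoeff]
  simp only [← h']
  rfl

/-- `dressed b y = (ℱ⁻¹⁽¹⁾ y ▷ b) σ(ℱ⁻¹⁽²⁾)`. -/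
theorem IsCocycle.dressed_eq (hF : F.IsCocycle) (b : 𝓐) (y : H⟦X⟧) :
    F.dressed κ ρ b y = mapCoeff (dress κ ρ b) (F.inv * mapAlg (inl 𝔤) y) := by
  have h1 : ∀ t : (H ⊗[ℂ] H)⟦X⟧, mapCoeff ((conj κ ρ).flip b) t =
      mapCoeff (dress κ ρ b) (mapCoeff (contract23 𝔤) (mapAlg (comulLeft 𝔤) t)) := by
    intro t
    rw [mapCoeff_mapAlg, mapCoeff_mapCoeff]
    exact mapCoeff_congr (fun s => conj_eq_dress κ ρ s b) _
  have h2 := fun x t => mapCoeff_mul_swap (L := contract23 𝔤)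
    (f := (comulLeft 𝔤).toLinearMap ∘ₗ (inr 𝔤).toLinearMap) (g := LinearMap.id)
    (f' := (inr 𝔤).toLinearMap ∘ₗ anti 𝔤) (g' := contract23 𝔤)
    (fun (x : H) t => by
      induction t using tensor₃_induction with
      | zero => simp
      | add s t hs ht => rw [map_add, mul_add, map_add, hs, ht, map_add, add_mul]
      | tmul p q r =>
        simp [comulLeft_tmul, map_one, Algebra.TensorProduct.one_def, anti_mul, mul_assoc]) x t
  have h3 := fun t y => mapCoeff_mul (L := contract23 𝔤) (f := LinearMap.id)
    (g := (comulLeft 𝔤).toLinearMap ∘ₗ (Δ).toLinearMap) (f' := contract23 𝔤)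
    (g' := (inl 𝔤).toLinearMap)
    (fun t (y : H) => by
      have e : counitRight 𝔤 (Δ y) = y := by
        have := congrArg (TensorProduct.rid ℂ H) (Coalgebra.lTensor_counit_comul (R := ℂ) y)
        rw [TensorProduct.rid_tmul, one_smul] at this
        exact this
      change contract23 𝔤 (t * comulLeft 𝔤 (Δ y)) = _
      rw [comulLeft_comul, contract23_mul_comulRight, AlgHom.comp_apply, AlgHom.comp_apply, e]
      induction t using tensor₃_induction with
      | zero => simp
      | add s t hs ht => rw [add_mul, map_add, hs, ht, map_add, add_mul]
      | tmul p q r => simp) t y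
  simp only [← mapCoeff_mapCoeff, mapCoeff_toLinearMap, mapCoeff_id] at h2 h3
  rw [dressed, h1, map_mul, h2, show mapCoeff (anti 𝔤) (antiSeries F.gamma) = F.gamma from
    antiSeries_antiSeries _, map_mul, h3, hF.contract23_comulLeft,
    mul_assoc, mul_assoc, inl_mul_inr_series, ← mul_assoc (mapAlg (inr 𝔤) F.gammaInv), ← map_mul,
    hF.gammaInv_mul_gamma, map_one, one_mul]

variable (F) in
/-- The twisted coproduct factor `(id ⊗ Δ)(ℱ⁻¹) (1 ⊗ ℱ⁻¹)`. -/
def tripleInv : (H ⊗[ℂ] (H ⊗[ℂ] H))⟦X⟧ :=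
  mapAlg (comulRight 𝔤) F.inv * mapAlg (leg23 𝔤) F.inv

theorem IsCocycle.dressed_mul_dressed (hF : F.IsCocycle) (b c : 𝓐) (y z : H⟦X⟧) :
    F.dressed κ ρ b y * F.dressed κ ρ c z = mapCoeff (dress₂ κ ρ b c)
      (F.tripleInv * mapAlg (leg12 𝔤) (mapAlg (inl 𝔤) y * mapAlg (inr 𝔤) z)) := by
  have h := fun s t => mapCoeff_mul (L := dress₂ κ ρ b c) (f := (comulRight 𝔤).toLinearMap)
    (g := (leg23 𝔤).toLinearMap) (f' := dress κ ρ b) (g' := dress κ ρ c)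
    (fun s t => (dress_mul_dress κ ρ b c s t).symm) s t
  simp only [mapCoeff_toLinearMap] at h
  have e1 : mapAlg (comulRight 𝔤) (mapAlg (inl 𝔤) y) = mapAlg (leg12 𝔤) (mapAlg (inl 𝔤) y) := by
    ext n; simp [map_one, Algebra.TensorProduct.one_def]
  have e2 : mapAlg (leg23 𝔤) (mapAlg (inl 𝔤) z) = mapAlg (leg12 𝔤) (mapAlg (inr 𝔤) z) := by
    ext n; simp
  have e3 : ∀ t, mapAlg (leg12 𝔤) (mapAlg (inl 𝔤) y) * mapAlg (leg23 𝔤) t =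
      mapAlg (leg23 𝔤) t * mapAlg (leg12 𝔤) (mapAlg (inl 𝔤) y) := by
    intro t
    have := mapCoeff_mul_swap (L := LinearMap.id)
      (f := (leg12 𝔤).toLinearMap ∘ₗ (inl 𝔤).toLinearMap)
      (f' := (leg12 𝔤).toLinearMap ∘ₗ (inl 𝔤).toLinearMap) (g := (leg23 𝔤).toLinearMap)
      (g' := (leg23 𝔤).toLinearMap) (fun a b => by
        simp [← Algebra.TensorProduct.one_def]) y t
    simpa only [← mapCoeff_mapCoeff, mapCoeff_toLinearMap, mapCoeff_id] using this
  rw [hF.dressed_eq, hF.dressed_eq, ← h, map_mul, map_mul, map_mul, e1, e2, mul_assoc, tripleInv,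
    mul_assoc, ← mul_assoc (mapAlg (leg12 𝔤) (mapAlg (inl 𝔤) y)), e3, mul_assoc]

theorem IsCocycle.flip12_tripleInv (hF : F.IsCocycle) (Y : (H ⊗[ℂ] H)⟦X⟧) :
    mapAlg (flip12 𝔤) (F.tripleInv * mapAlg (leg12 𝔤) Y) =
      F.tripleInv * mapAlg (leg12 𝔤) (mapAlg (flip 𝔤) F.universalR * mapAlg (flip 𝔤) Y) := by
  have e : (flip12 𝔤).comp (leg12 𝔤) = (leg12 𝔤).comp (flip 𝔤) :=
    tensor₂_algHom_ext (by simp) (by simp)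
  rw [tripleInv, ← hF.inv_eq]
  simp only [map_mul, flip_universalR]
  simp only [mapAlg_mapAlg, flip12_comp_comulLeft, e]
  simp only [mul_assoc]
  rw [← mul_assoc (mapAlg (leg12 𝔤) F.inv), F.map_inv_mul, one_mul]

variable {κ ρ}

theorem _root_.DeformedCCR.IsCovariant.mapCoeff_dress₂ {b c : I → 𝓐} {n m : I → I → H →ₗ[ℂ] ℂ}
    (hb : IsCovariant κ ρ b n) (hc : IsCovariant κ ρ c m) (i j : I)
    (t : (H ⊗[ℂ] (H ⊗[ℂ] H))⟦X⟧) (s : (H ⊗[ℂ] H)⟦X⟧) :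
    mapCoeff (dress₂ κ ρ (b i) (c j)) (t * mapAlg (leg12 𝔤) s) =
      ∑ u, ∑ v, mapCoeff (pairing (n u i) (m v j)) s •
        mapCoeff (dress₂ κ ρ (b u) (c v)) t := by
  have h := mapCoeff_mul_eq_sum_smul (L := dress₂ κ ρ (b i) (c j)) (f := LinearMap.id)
    (g := (leg12 𝔤).toLinearMap) (φ := fun p : I × I => pairing (n p.1 i) (m p.2 j))
    (ψ := fun p => dress₂ κ ρ (b p.1) (c p.2)) (fun s t => hb.dress₂_mul_leg12 hc i j s t) t s
  rw [Fintype.sum_prod_type] at h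
  simpa only [mapCoeff_id, mapCoeff_toLinearMap] using h

theorem _root_.DeformedCCR.IsCovariant.mapCoeff_dress₂_comm {b c : I → 𝓐}
    {n m : I → I → H →ₗ[ℂ] ℂ}
    (hb : IsCovariant κ ρ b n) (hc : IsCovariant κ ρ c m)
    (h : ∀ i j, b i * c j = κ.sign • (c j * b i)) (i j : I) (t : (H ⊗[ℂ] (H ⊗[ℂ] H))⟦X⟧) :
    mapCoeff (dress₂ κ ρ (b i) (c j)) t =
      κ.sign • mapCoeff (dress₂ κ ρ (c j) (b i)) (mapAlg (flip12 𝔤) t) := by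
  rw [mapCoeff_mapAlg, ← mapCoeff_zsmul_left]
  exact mapCoeff_congr (fun s => hb.dress₂_comm hc h i j s) t

theorem Rmatrix_eq (i j h k : I) :
    F.Rmatrix ρ i j h k = mapCoeff (pairing (repEntry ρ i h) (repEntry ρ j k)) F.universalR :=
  rfl

theorem Rmatrix_eq_flip (i j h k : I) :
    F.Rmatrix ρ i j h k = mapCoeff (pairing (repEntry ρ j k) (repEntry ρ i h))
      (mapAlg (flip 𝔤) F.universalR) := by
  rw [Rmatrix_eq, mapCoeff_mapAlg]
  refine mapCoeff_congr (fun t => ?_) _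
  induction t with
  | zero => simp
  | add s t hs ht => rw [map_add, map_add, hs, ht]
  | tmul x y => simp [mul_comm]

variable (κ ρ)

theorem IsCocycle.Aplus_mul_Aplus (hF : F.IsCocycle) (i j : I) :
    F.Aplus κ ρ i * F.Aplus κ ρ j =
      κ.sign • ∑ u, ∑ v, F.Rmatrix ρ v u i j • (F.Aplus κ ρ u * F.Aplus κ ρ v) := by
  have hc := isCovariant_aPlus κ ρ
  simp only [Aplus_eq_dressed, hF.dressed_mul_dressed, map_one, mul_one]
  have e := hF.flip12_tripleInv 1
  rw [map_one, map_one, mul_one, mul_one] at e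
  rw [hc.mapCoeff_dress₂_comm hc OscAlg.cre_mul_cre, e, hc.mapCoeff_dress₂ hc]
  simp only [Rmatrix_eq_flip]

theorem IsCocycle.A_mul_A (hF : F.IsCocycle) (i j : I) :
    F.A κ ρ i * F.A κ ρ j =
      κ.sign • ∑ u, ∑ v, F.Rmatrix ρ i j v u • (F.A κ ρ u * F.A κ ρ v) := by
  have hc := isCovariant_a κ ρ
  simp only [hF.A_eq_dressed, hF.dressed_mul_dressed]
  rw [hc.mapCoeff_dress₂_comm hc OscAlg.ann_mul_ann, hF.flip12_tripleInv, map_mul (mapAlg (flip 𝔤)),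
    flip_inl_series, flip_inr_series, ← inl_mul_inr_series,
    hF.flip_universalR_mul_gamma'_tmul_gamma', map_mul (mapAlg (leg12 𝔤)), ← mul_assoc,
    hc.mapCoeff_dress₂ hc]
  congr 1
  refine Finset.sum_congr rfl fun u _ => Finset.sum_congr rfl fun v _ => ?_
  rw [Rmatrix_eq_flip, mapCoeff_mapCoeff]
  congr 1
  refine mapCoeff_congr (fun t => ?_) _
  induction t with
  | zero => simp
  | add s t hs ht => rw [map_add, map_add, hs, ht]
  | tmul x y => simp [anti_anti]

theorem IsCocycle.A_mul_Aplus (hF : F.IsCocycle) (i j : I) :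
    F.A κ ρ i * F.Aplus κ ρ j = (if i = j then 1 else 0) +
      κ.sign • ∑ u, ∑ v, F.Rmatrix ρ u i j v • (F.Aplus κ ρ u * F.A κ ρ v) := by
  have hc := isCovariant_aPlus κ ρ
  have ha := isCovariant_a κ ρ
  simp only [hF.A_eq_dressed, Aplus_eq_dressed, hF.dressed_mul_dressed, map_one, one_mul, mul_one]
  have e : ∀ t, mapCoeff (dress₂ κ ρ (a κ i) (aPlus κ j)) t =
      mapCoeff (contractedPart κ ρ i j) t +
        κ.sign • mapCoeff (dress₂ κ ρ (aPlus κ j) (a κ i)) (mapAlg (flip12 𝔤) t) := by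
    intro t
    rw [mapCoeff_mapAlg, ← mapCoeff_zsmul_left, ← mapCoeff_add_left]
    exact mapCoeff_congr (fun s => dress₂_a_aPlus κ ρ i j s) t
  rw [e, hF.flip12_tripleInv, flip_inl_series, hF.flip_universalR_mul_gamma',
    map_mul (mapAlg (leg12 𝔤)), ← mul_assoc, hc.mapCoeff_dress₂ ha]
  congr 1
  · have h := fun s t => mapCoeff_mul_eq_sum_smul (J := Unit) (L := contractedPart κ ρ i j)
      (f := (comulLeft 𝔤).toLinearMap) (g := (leg12 𝔤).toLinearMap)
      (φ := fun _ => repEntry ρ i j ∘ₗ antiMul 𝔤)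
      (ψ := fun _ => (σ).toLinearMap ∘ₗ (counitLeft 𝔤).toLinearMap)
      (fun s t => by
        rw [Fintype.sum_unique]
        exact contractedPart_comulLeft_mul_leg12 κ ρ i j s t) s t
    have h' := mapCoeff_mul_swap (L := antiMul 𝔤) (f := LinearMap.id) (g := (inl 𝔤).toLinearMap)
      (f' := antiMul 𝔤) (g' := anti 𝔤) (fun s x => by
        change antiMul 𝔤 (s * x ⊗ₜ 1) = _
        rw [antiMul_mul_tmul, mul_one]) F.inv F.gamma'
    simp only [Fintype.sum_unique, ← mapCoeff_mapCoeff, mapCoeff_toLinearMap, mapCoeff_id] at h h'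
    rw [tripleInv, ← hF.inv_eq, mul_assoc, ← map_mul, h, F.counitLeft_inv, map_one, h', ← gamma_eq,
      show mapCoeff (anti 𝔤) F.gamma' = F.gammaInv from F.antiSeries_gamma', hF.gammaInv_mul_gamma]
    ext n
    rw [Algebra.smul_def, mul_one]
    change coeff n (PowerSeries.map (algebraMap ℂ 𝓐) _) = _
    rw [coeff_map, coeff_mapCoeff, coeff_one]
    by_cases hn : n = 0 <;> by_cases hij : i = j <;>
      simp [hn, hij, repEntry_apply, coeff_one]
  · congr 1
    refine Finset.sum_congr rfl fun u _ => Finset.sum_congr rfl fun v _ => ?_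
    rw [Rmatrix_eq, mapCoeff_mapCoeff]
    congr 1
    refine mapCoeff_congr (fun t => ?_) _
    induction t with
    | zero => simp
    | add s t hs ht => rw [map_add, map_add, hs, ht]
    | tmul x y => simp [antipodeRight, anti_anti]

end Twist

/-! ## Deforming maps -/

section DeformingMap

variable {κ : Kind} {I : Type*} [DecidableEq I]

/-- Induction over the Weyl or Clifford algebra. -/
theorem OscAlg.induction {p : OscAlg κ I → Prop} (y : OscAlg κ I)
    (scalar : ∀ r, p (algebraMap ℂ _ r)) (gen : ∀ g, p (OscAlg.gen κ g))
    (mul : ∀ a b, p a → p b → p (a * b)) (add : ∀ a b, p a → p b → p (a + b)) : p y := by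
  obtain ⟨x, rfl⟩ := RingQuot.mkAlgHom_surjective ℂ (ClassicalRel κ I) y
  induction x using FreeAlgebra.induction with
  | grade0 r =>
    have : RingQuot.mkAlgHom ℂ (ClassicalRel κ I) (algebraMap ℂ _ r) =
      algebraMap ℂ (RingQuot (ClassicalRel κ I)) r := AlgHom.commutes _ r
    rw [this]
    exact scalar r
  | grade1 g => exact gen g
  | mul a b ha hb => rw [map_mul]; exact mul _ _ ha hb
  | add a b ha hb => rw [map_add]; exact add _ _ ha hb

theorem X_pow_smul (n : ℕ) (y : (OscAlg κ I)⟦X⟧) : (X ^ n : ℂ⟦X⟧) • y = X ^ n * y := by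
  rw [Algebra.smul_def]
  change PowerSeries.map (algebraMap ℂ (OscAlg κ I)) (X ^ n) * y = _
  rw [map_pow, map_X]

variable [Fintype I] {R : I → I → I → I → ℂ⟦X⟧}

theorem QuantumAlg.algHom_ext {B : Type*} [Semiring B] [Algebra ℂ⟦X⟧ B]
    {f g : QuantumAlg κ R →ₐ[ℂ⟦X⟧] B} (h : ∀ x, f (QuantumAlg.gen κ R x) = g (QuantumAlg.gen κ R x)) :
    f = g :=
  RingQuot.ringQuot_ext' _ _ _ (FreeAlgebra.hom_ext (funext h))

/-- The algebra homomorphism out of the deformed algebra determined by elements that satisfy the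
quantum commutation relations. -/
theorem QuantumAlg.exists_lift {B : Type*} [Ring B] [Algebra ℂ⟦X⟧ B] (x y : I → B)
    (hxy : ∀ i j, x i * y j = (if i = j then 1 else 0) +
      κ.sign • ∑ u, ∑ v, R u i j v • (y u * x v))
    (hxx : ∀ i j, x i * x j = κ.sign • ∑ u, ∑ v, R i j v u • (x u * x v))
    (hyy : ∀ i j, y i * y j = κ.sign • ∑ u, ∑ v, R v u i j • (y u * y v)) :
    ∃ f : QuantumAlg κ R →ₐ[ℂ⟦X⟧] B, (∀ i, f (QuantumAlg.gen κ R (.ann i)) = x i) ∧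
      ∀ i, f (QuantumAlg.gen κ R (.cre i)) = y i := by
  let φ : FreeAlgebra ℂ⟦X⟧ (Gen I) →ₐ[ℂ⟦X⟧] B :=
    FreeAlgebra.lift ℂ⟦X⟧ fun g => match g with
      | .ann i => x i
      | .cre i => y i
  have h₁ : ∀ i, φ (FreeAlgebra.ι ℂ⟦X⟧ (.ann i)) = x i := fun i => FreeAlgebra.lift_ι_apply _ _
  have h₂ : ∀ i, φ (FreeAlgebra.ι ℂ⟦X⟧ (.cre i)) = y i := fun i => FreeAlgebra.lift_ι_apply _ _
  have w : ∀ ⦃s t⦄, QuantumRel κ R s t → φ s = φ t := by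
    intro s t h
    cases h with
    | ann_cre i j =>
      simp only [map_mul, map_add, map_zsmul, map_sum, map_smul, h₁, h₂, hxy i j]
      split <;> simp
    | ann_ann i j => simp only [map_mul, map_zsmul, map_sum, map_smul, h₁, hxx i j]
    | cre_cre i j => simp only [map_mul, map_zsmul, map_sum, map_smul, h₂, hyy i j]
  refine ⟨RingQuot.liftAlgHom ℂ⟦X⟧ ⟨φ, w⟩, fun i => ?_, fun i => ?_⟩
  · exact (RingQuot.liftAlgHom_mkAlgHom_apply ℂ⟦X⟧ φ w _).trans (h₁ i)
  · exact (RingQuot.liftAlgHom_mkAlgHom_apply ℂ⟦X⟧ φ w _).trans (h₂ i)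

/-- Induction over the deformed algebra. -/
theorem QuantumAlg.induction {p : QuantumAlg κ R → Prop} (y : QuantumAlg κ R)
    (scalar : ∀ r, p (algebraMap ℂ⟦X⟧ _ r)) (gen : ∀ g, p (QuantumAlg.gen κ R g))
    (mul : ∀ a b, p a → p b → p (a * b)) (add : ∀ a b, p a → p b → p (a + b)) : p y := by
  obtain ⟨x, rfl⟩ := RingQuot.mkAlgHom_surjective ℂ⟦X⟧ (QuantumRel κ R) y
  induction x using FreeAlgebra.induction with
  | grade0 r =>
    have : RingQuot.mkAlgHom ℂ⟦X⟧ (QuantumRel κ R) (algebraMap ℂ⟦X⟧ _ r) =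
      algebraMap ℂ⟦X⟧ (RingQuot (QuantumRel κ R)) r := AlgHom.commutes _ r
    rw [this]
    exact scalar r
  | grade1 g => exact gen g
  | mul a b ha hb => rw [map_mul]; exact mul _ _ ha hb
  | add a b ha hb => rw [map_add]; exact add _ _ ha hb

theorem QuantumAlg.ann_mul_cre (i j : I) :
    gen κ R (.ann i) * gen κ R (.cre j) = (if i = j then 1 else 0) +
      κ.sign • ∑ u, ∑ v, R u i j v • (gen κ R (.cre u) * gen κ R (.ann v)) := by
  have h := RingQuot.mkAlgHom_rel ℂ⟦X⟧ (QuantumRel.ann_cre (κ := κ) (R := R) i j)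
  simp only [map_mul, map_add, map_zsmul, map_sum, map_smul,
    apply_ite (RingQuot.mkAlgHom ℂ⟦X⟧ _), map_one, map_zero] at h
  exact h

theorem QuantumAlg.ann_mul_ann (i j : I) :
    gen κ R (.ann i) * gen κ R (.ann j) =
      κ.sign • ∑ u, ∑ v, R i j v u • (gen κ R (.ann u) * gen κ R (.ann v)) := by
  have h := RingQuot.mkAlgHom_rel ℂ⟦X⟧ (QuantumRel.ann_ann (κ := κ) (R := R) i j)
  simp only [map_mul, map_zsmul, map_sum, map_smul] at h
  exact h

theorem QuantumAlg.cre_mul_cre (i j : I) :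
    gen κ R (.cre i) * gen κ R (.cre j) =
      κ.sign • ∑ u, ∑ v, R v u i j • (gen κ R (.cre u) * gen κ R (.cre v)) := by
  have h := RingQuot.mkAlgHom_rel ℂ⟦X⟧ (QuantumRel.cre_cre (κ := κ) (R := R) i j)
  simp only [map_mul, map_zsmul, map_sum, map_smul] at h
  exact h

variable (κ R) in
/-- The ideal `h 𝒜_h`. -/
def QuantumAlg.hIdeal : Ideal (QuantumAlg κ R) where
  carrier := {x | ∃ z, x = (X : ℂ⟦X⟧) • z}
  zero_mem' := ⟨0, by rw [smul_zero]⟩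
  add_mem' := by
    rintro _ _ ⟨x, rfl⟩ ⟨y, rfl⟩
    exact ⟨x + y, by rw [smul_add]⟩
  smul_mem' := by
    rintro c _ ⟨x, rfl⟩
    exact ⟨c * x, by rw [smul_eq_mul, mul_smul_comm]⟩

theorem QuantumAlg.mem_hIdeal {x : QuantumAlg κ R} :
    x ∈ hIdeal κ R ↔ ∃ z, x = (X : ℂ⟦X⟧) • z :=
  Iff.rfl

instance : (QuantumAlg.hIdeal κ R).IsTwoSided where
  mul_mem_of_left := by
    rintro _ b ⟨x, rfl⟩
    exact ⟨x * b, by rw [smul_mul_assoc]⟩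

instance : Algebra ℂ (QuantumAlg κ R) :=
  Algebra.compHom _ (algebraMap ℂ ℂ⟦X⟧)

theorem QuantumAlg.algebraMap_complex (c : ℂ) :
    algebraMap ℂ (QuantumAlg κ R) c = algebraMap ℂ⟦X⟧ _ (C c) := rfl

/-- Modulo `h`, scalars act through their constant term. -/
theorem QuantumAlg.mk_smul (c : ℂ⟦X⟧) (x : QuantumAlg κ R) :
    Ideal.Quotient.mk (hIdeal κ R) (c • x) =
      algebraMap ℂ _ (constantCoeff c) * Ideal.Quotient.mk (hIdeal κ R) x := by
  have h : algebraMap ℂ (QuantumAlg κ R ⧸ hIdeal κ R) (constantCoeff c) =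
      Ideal.Quotient.mk (hIdeal κ R) (algebraMap ℂ (QuantumAlg κ R) (constantCoeff c)) := rfl
  rw [h, ← map_mul, algebraMap_complex, Ideal.Quotient.eq, mem_hIdeal]
  refine ⟨(PowerSeries.mk fun p => coeff (p + 1) c) • x, ?_⟩
  conv_lhs => rw [eq_X_mul_shift_add_const c]
  rw [map_add, ← Algebra.smul_def, add_smul, mul_smul]
  simp

/-- `R ≡ 1 ⊗ 1` modulo `h`. -/
def IsUnitalModH (R : I → I → I → I → ℂ⟦X⟧) : Prop :=
  ∀ i j h k, constantCoeff (R i j h k) = if i = h ∧ j = k then 1 else 0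

/-- The homomorphism `𝒜 → 𝒜_h / h 𝒜_h` sending generators to generators. -/
theorem OscAlg.exists_hom_quotient (hR : IsUnitalModH R) :
    ∃ g : OscAlg κ I →ₐ[ℂ] QuantumAlg κ R ⧸ QuantumAlg.hIdeal κ R,
      ∀ x, g (OscAlg.gen κ x) =
        Ideal.Quotient.mk (QuantumAlg.hIdeal κ R) (QuantumAlg.gen κ R x) := by
  let q := Ideal.Quotient.mk (QuantumAlg.hIdeal κ R)
  let φ : FreeAlgebra ℂ (Gen I) →ₐ[ℂ] QuantumAlg κ R ⧸ QuantumAlg.hIdeal κ R :=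
    FreeAlgebra.lift ℂ fun x => q (QuantumAlg.gen κ R x)
  have h₁ : ∀ x, φ (FreeAlgebra.ι ℂ x) = q (QuantumAlg.gen κ R x) :=
    fun x => FreeAlgebra.lift_ι_apply _ _
  have sum_eq : ∀ (T : I → I → ℂ⟦X⟧) (z : I → I → QuantumAlg κ R) (i j : I),
      (∀ u v, constantCoeff (T u v) = if u = i ∧ v = j then 1 else 0) →
      q (∑ u, ∑ v, T u v • z u v) = q (z i j) := by
    intro T z i j hT
    simp only [map_sum, q, QuantumAlg.mk_smul, hT]
    rw [Finset.sum_eq_single i, Finset.sum_eq_single j]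
    · simp
    · intro v _ hv; simp [hv]
    · simp
    · intro u _ hu; simp [hu]
    · simp
  have w : ∀ ⦃s t⦄, ClassicalRel κ I s t → φ s = φ t := by
    intro s t h
    cases h with
    | ann_cre i j =>
      rw [map_sub, map_zsmul, map_mul, map_mul, h₁, h₁, ← map_mul q, QuantumAlg.ann_mul_cre,
        map_add, map_zsmul, sum_eq _ _ j i, ← map_mul q, add_sub_cancel_right]
      · split <;> simp
      · intro u v
        rw [hR]
        simp only [eq_comm]
    | ann_ann i j =>
      rw [map_sub, map_zsmul, map_mul, map_mul, h₁, h₁, ← map_mul q, QuantumAlg.ann_mul_ann,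
        map_zsmul, sum_eq _ _ j i, ← map_mul q, sub_self, map_zero]
      intro u v
      rw [hR]
      simp only [eq_comm, and_comm]
    | cre_cre i j =>
      rw [map_sub, map_zsmul, map_mul, map_mul, h₁, h₁, ← map_mul q, QuantumAlg.cre_mul_cre,
        map_zsmul, sum_eq _ _ j i, ← map_mul q, sub_self, map_zero]
      intro u v
      rw [hR]
      simp only [eq_comm, and_comm]
  exact ⟨RingQuot.liftAlgHom ℂ ⟨φ, w⟩,
    fun x => (RingQuot.liftAlgHom_mkAlgHom_apply ℂ φ w _).trans (h₁ x)⟩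

/-- A homomorphism `𝒜_h → 𝒜[[h]]` with the right classical limit is a deforming map, provided that
the quantum relations reduce to the classical ones modulo `h`. -/
theorem isDeformingMap_of_constantCoeff (hR : IsUnitalModH R)
    (f : QuantumAlg κ R →ₐ[ℂ⟦X⟧] (OscAlg κ I)⟦X⟧)
    (hf : ∀ g, constantCoeff (f (QuantumAlg.gen κ R g)) = OscAlg.gen κ g) : IsDeformingMap f := by
  have hscalar : ∀ c, constantCoeff (f (algebraMap ℂ⟦X⟧ _ c)) =
      algebraMap ℂ _ (constantCoeff c) := by
    intro c
    rw [AlgHom.commutes]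
    change constantCoeff (PowerSeries.map (algebraMap ℂ (OscAlg κ I)) c) = _
    rw [← coeff_zero_eq_constantCoeff_apply, coeff_map, coeff_zero_eq_constantCoeff_apply]
  have hsurj : ∀ y, ∃ x, constantCoeff (f x) = y := by
    intro y
    induction y using OscAlg.induction with
    | scalar r => exact ⟨algebraMap ℂ⟦X⟧ _ (C r), by rw [hscalar, constantCoeff_C]⟩
    | gen g => exact ⟨_, hf g⟩
    | mul a b ha hb =>
      obtain ⟨x, rfl⟩ := ha
      obtain ⟨y, rfl⟩ := hb
      exact ⟨x * y, by rw [map_mul, map_mul]⟩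
    | add a b ha hb =>
      obtain ⟨x, rfl⟩ := ha
      obtain ⟨y, rfl⟩ := hb
      exact ⟨x + y, by rw [map_add, map_add]⟩
  have hinj : ∀ x, constantCoeff (f x) = 0 → ∃ z, x = (X : ℂ⟦X⟧) • z := by
    obtain ⟨g, hg⟩ := OscAlg.exists_hom_quotient (κ := κ) hR
    have key : ∀ x, g (constantCoeff (f x)) = Ideal.Quotient.mk (QuantumAlg.hIdeal κ R) x := by
      intro x
      induction x using QuantumAlg.induction with
      | scalar r =>
        rw [hscalar, AlgHom.commutes, Algebra.algebraMap_eq_smul_one (A := QuantumAlg κ R),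
          QuantumAlg.mk_smul, map_one, mul_one]
      | gen x => rw [hf, hg]
      | mul a b ha hb => rw [map_mul, map_mul, map_mul, map_mul, ha, hb]
      | add a b ha hb => rw [map_add, map_add, map_add, map_add, ha, hb]
    intro x hx
    have := key x
    rw [hx, map_zero] at this
    exact Ideal.Quotient.eq_zero_iff_mem.1 this.symm
  refine ⟨hf, fun n => ?_, fun n y => ?_⟩
  · induction n with
    | zero => exact fun x y _ => ⟨x, by rw [pow_zero, one_smul]⟩
    | succ n ih =>
      intro x y h
      rw [X_pow_smul] at h
      obtain ⟨z, rfl⟩ := hinj x (by rw [h, map_mul, map_pow, constantCoeff_X]; simp)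
      rw [map_smul, ← pow_one (X : ℂ⟦X⟧), X_pow_smul, pow_one, pow_succ', mul_assoc] at h
      obtain ⟨w, rfl⟩ := ih z y (by rw [X_pow_smul]; exact X_mul_cancel h)
      exact ⟨w, by rw [smul_smul, pow_succ']⟩
  · induction n with
    | zero => exact ⟨0, y, by rw [map_zero, pow_zero, one_smul, zero_add]⟩
    | succ n ih =>
      obtain ⟨x, z, hz⟩ := ih
      obtain ⟨x', hx'⟩ := hsurj (constantCoeff z)
      obtain ⟨z', hz'⟩ := (X_dvd_iff (φ := z - f x')).2
        (by rw [map_sub, hx', sub_self])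
      refine ⟨x + (X ^ n : ℂ⟦X⟧) • x', z', ?_⟩
      rw [hz, map_add, map_smul, add_assoc, X_pow_smul, X_pow_smul, X_pow_smul, pow_succ,
        mul_assoc, ← hz', ← mul_add, add_sub_cancel]

end DeformingMap

namespace Twist

variable {𝔤 : Type*} [LieRing 𝔤] [LieAlgebra ℂ 𝔤] {I : Type*} [Fintype I] [DecidableEq I]
  (κ : Kind) (ρ : Ug 𝔤 →ₐ[ℂ] Matrix I I ℂ) {F : Twist 𝔤}

local notation "H" => Ug 𝔤

theorem constantCoeff_gamma' : constantCoeff F.gamma' = 1 := by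
  rw [gamma'_eq, gammaInv_eq, constantCoeff_mapCoeff, F.swap.constantCoeff_eq,
    Algebra.TensorProduct.one_def, mulAnti_tmul, anti_one, mul_one]

theorem IsCocycle.constantCoeff_dressed (hF : F.IsCocycle) (b : OscAlg κ I) (y : H⟦X⟧)
    (hy : constantCoeff y = 1) : constantCoeff (F.dressed κ ρ b y) = b := by
  rw [hF.dressed_eq, constantCoeff_mapCoeff, map_mul, constantCoeff_inv, constantCoeff_mapAlg, hy,
    map_one, mul_one, Algebra.TensorProduct.one_def, dress_tmul, adj_one, map_one, mul_one]

variable (F) in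
theorem isUnitalModH_Rmatrix : IsUnitalModH (F.Rmatrix ρ) := by
  intro i j h k
  have e : constantCoeff F.universalR = 1 := by
    change constantCoeff (mapAlg (flip 𝔤) F.series * F.inv) = 1
    rw [map_mul, constantCoeff_mapAlg, F.constantCoeff_eq, constantCoeff_inv, map_one, mul_one]
  rw [Rmatrix_eq, constantCoeff_mapCoeff, e, Algebra.TensorProduct.one_def]
  simp only [LinearMap.comp_apply, TensorProduct.map_tmul, LinearMap.mul'_apply, repEntry_apply,
    map_one, Matrix.one_apply, ite_and]
  split_ifs <;> simp

end Twist

end DeformedCCR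

end

theorem mainTheorem1 {𝔤 : Type*} [LieRing 𝔤] [LieAlgebra ℂ 𝔤] {I : Type*} [Fintype I]
    [DecidableEq I] (ρ : DeformedCCR.Ug 𝔤 →ₐ[ℂ] Matrix I I ℂ) (κ : DeformedCCR.Kind)
    (F : DeformedCCR.Twist 𝔤) (hF : F.IsCocycle) :
    -- the quadratic relations
    (∀ i j : I, F.A κ ρ i * F.Aplus κ ρ j =
      (if i = j then 1 else 0) +
        κ.sign • ∑ u, ∑ v, F.Rmatrix ρ u i j v • (F.Aplus κ ρ u * F.A κ ρ v)) ∧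
    (∀ i j : I, F.A κ ρ i * F.A κ ρ j =
      κ.sign • ∑ u, ∑ v, F.Rmatrix ρ i j v u • (F.A κ ρ u * F.A κ ρ v)) ∧
    (∀ i j : I, F.Aplus κ ρ i * F.Aplus κ ρ j =
      κ.sign • ∑ u, ∑ v, F.Rmatrix ρ v u i j • (F.Aplus κ ρ u * F.Aplus κ ρ v)) ∧
    -- covariance under the twisted Hopf algebra
    (∀ (x : (DeformedCCR.Ug 𝔤)⟦X⟧) (i : I), F.act κ ρ x (F.Aplus κ ρ i) =
      ∑ l, DeformedCCR.repCoeff ρ x l i • F.Aplus κ ρ l) ∧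
    (∀ (x : (DeformedCCR.Ug 𝔤)⟦X⟧) (i : I), F.act κ ρ x (F.A κ ρ i) =
      ∑ l, DeformedCCR.repCoeff ρ (F.antipode x) i l • F.A κ ρ l) ∧
    -- the deforming map
    (∃! f : DeformedCCR.QuantumAlg κ (F.Rmatrix ρ) →ₐ[PowerSeries ℂ]
        PowerSeries (DeformedCCR.OscAlg κ I),
      (∀ i : I, f (DeformedCCR.QuantumAlg.gen κ _ (.ann i)) = F.A κ ρ i) ∧
      (∀ i : I, f (DeformedCCR.QuantumAlg.gen κ _ (.cre i)) = F.Aplus κ ρ i) ∧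
      DeformedCCR.IsDeformingMap f) := by
  refine ⟨hF.A_mul_Aplus κ ρ, hF.A_mul_A κ ρ, hF.Aplus_mul_Aplus κ ρ, hF.act_Aplus κ ρ,
    hF.act_A κ ρ, ?_⟩
  obtain ⟨f, hA, hAplus⟩ := DeformedCCR.QuantumAlg.exists_lift (F.A κ ρ) (F.Aplus κ ρ)
    (hF.A_mul_Aplus κ ρ) (hF.A_mul_A κ ρ) (hF.Aplus_mul_Aplus κ ρ)
  refine ⟨f, ⟨hA, hAplus, DeformedCCR.isDeformingMap_of_constantCoeff
    (F.isUnitalModH_Rmatrix ρ) f ?_⟩, ?_⟩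
  · rintro (i | i)
    · rw [hA, hF.A_eq_dressed, hF.constantCoeff_dressed κ ρ _ _
        DeformedCCR.Twist.constantCoeff_gamma']
    · rw [hAplus, DeformedCCR.Twist.Aplus_eq_dressed, hF.constantCoeff_dressed κ ρ _ _
        (map_one _)]
  · rintro g ⟨gA, gAplus, -⟩
    refine DeformedCCR.QuantumAlg.algHom_ext ?_
    rintro (i | i)
    · rw [hA, gA]
    · rw [hAplus, gAplus]
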